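/- Let $\mathcal X,\mathcal Y$ (inputs) and $\mathcal A,\mathcal B$ (outcomes) be finite sets. A conditional distribution $\mathbf p=(p(a,b|x,y))$ is non-signaling if $\sum_b p(a,b|x,y)$ does not depend on $y$ and $\sum_a p(a,b|x,y)$ does not depend on $x$. It is local if it is a convex combination of distributions of the form $\delta_{a=\lambda_A(x)}\,\delta_{b=\lambda_B(y)}$ with $\lambda_A:\mathcal X\to\mathcal A$, $\lambda_B:\mathcal Y\to\mathcal B$. It is quantum if there are a Hilbert space, a unit vector $\psi$ in it and projective measurements $(E_a(x))_{a\in\mathcal A}$, $(F_b(y))_{b\in\mathcal B}$ with $E_a(x)F_b(y)=F_b(y)E_a(x)$ such that $p(a,b|x,y)=\langle\psi|E_a(x)F_b(y)|\psi\rangle$. Let $\mathcal L$ and $\mathcal Q$ be the sets of local and of quantum distributions, and define $$\tilde\nu(\mathbf p)=\inf\Big\{\sum_i|q_i| : \mathbf p=\sum_i q_i\mathbf p_i,\ q_i\in\mathbb R,\ \mathbf p_i\in\mathcal L\Big\},\qquad \tilde\gamma_2(\mathbf p)=\inf\Big\{\sum_i|q_i| : \mathbf p=\sum_i q_i\mathbf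 p_i,\ q_i\in\mathbb R,\ \mathbf p_i\in\mathcal Q\Big\},$$ the sums being finite. Suppose that Alice receives $x$, Bob receives $y$, and after communicating they must output $a$ and $b$ distributed exactly according to $p(a,b|x,y)$. Let $R_0^{\mathrm{pub}}(\mathbf p)$ be the least number of bits, in the worst case, exchanged by a classical two-way protocol with shared randomness that achieves this, and $Q_0^{\mathrm{ent}}(\mathbf p)$ the least number of qubits exchanged by a two-way quantum protocol with arbitrary shared entanglement that achieves this. In the quantum model the operations of a player act on the player's part of the shared entangled system and on the message qubits that the player currently holds, and locality is expressed, as for $\mathcal Q$, by commutation of operators on different parts; this includes the tensor product model with registers of any dimension. For $C:\mathcal X\times\mathcal Y\to[-1,1]$ write $R_0^{\mathrm{pub}}(C)$, $Q_0^{\mathrm{ent}}(C)$, $\tilde\nu(C)$, $\tilde\gamma_2(C)$ for the corresponding quantities of the distribution $p(a,b|x,y)=\frac14(1+ab\,C(x,y))$ on $a,b\in\{\pm1\}$, which has correlations $C$ and uniform marginals. Theorem. Let $\mathbf p$ be a non-signaling distribution over $\mathcal A\times\mathcal B$ with input set $\mathcal X\times\mathcal Y$, let $C:\mathcal X\times\mathcal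 Y\to[-1,1]$, and let $t,q\ge 0$ be integers. 1. If $R_0^{\mathrm{pub}}(\mathbf p)\le t$, then $\tilde\nu(\mathbf p)\le 2^{t+1}-1$. 2. If $R_0^{\mathrm{pub}}(C)\le t$, then $\tilde\nu(C)\le 2^{t}$. 3. If $Q_0^{\mathrm{ent}}(\mathbf p)\le q$, then $\tilde\gamma_2(\mathbf p)\le 2^{2q+1}-1$. 4. If $Q_0^{\mathrm{ent}}(C)\le q$, then $\tilde\gamma_2(C)\le 2^{q}$. -/

import Mathlib

open MeasureTheory

noncomputable section

/-! ### Bipartite conditional distributions -/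

/-- A family of numbers `p x y a b`, read as `p(a,b|x,y)`. -/
abbrev Behavior (X Y A B : Type*) := X → Y → A → B → ℝ

/-- `p` is a non-signaling conditional probability distribution. -/
structure IsNonSignaling {X Y A B : Type*} [Fintype A] [Fintype B]
    (p : Behavior X Y A B) : Prop where
  nonneg : ∀ x y a b, 0 ≤ p x y a b
  sum_eq_one : ∀ x y, ∑ a, ∑ b, p x y a b = 1
  marginal_alice : ∀ a x y y', ∑ b, p x y a b = ∑ b, p x y' a b
  marginal_bob : ∀ b x x' y, ∑ a, p x y a b = ∑ a, p x' y a b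

/-- The distribution over outcomes `±1` with correlations `C` and uniform marginals. -/
def ofCorrelation {X Y : Type*} (C : X → Y → ℝ) : Behavior X Y ℤˣ ℤˣ :=
  fun x y a b => (1 + ((a : ℤ) : ℝ) * ((b : ℤ) : ℝ) * C x y) / 4

/-! ### Local and quantum distributions -/

def localDeterministic {X Y A B : Type*} [DecidableEq A] [DecidableEq B]
    (f : X → A) (g : Y → B) : Behavior X Y A B :=
  fun x y a b => if a = f x ∧ b = g y then 1 else 0

/-- Convex combinations of local deterministic distributions. -/
def localSet (X Y A B : Type*) [DecidableEq A] [DecidableEq B] : Set (Behavior X Y A B) :=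
  convexHull ℝ {p | ∃ (f : X → A) (g : Y → B), p = localDeterministic f g}

/-- `E` is a projective measurement on `H` with outcomes in `A`. -/
structure IsProjectiveMeasurement {A H : Type*} [Fintype A] [NormedAddCommGroup H]
    [InnerProductSpace ℂ H] [CompleteSpace H] (E : A → H →L[ℂ] H) : Prop where
  selfAdjoint : ∀ a, IsSelfAdjoint (E a)
  idem : ∀ a, E a * E a = E a
  orthogonal : ∀ a a', a ≠ a' → E a * E a' = 0
  sum_eq_one : ∑ a, E a = 1

/-- Distributions obtained by measuring a state of an arbitrary Hilbert space with commuting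
projective measurements. -/
def quantumSet (X Y A B : Type*) [Fintype A] [Fintype B] : Set (Behavior X Y A B) :=
  {p | ∃ (H : Type) (_ : NormedAddCommGroup H) (_ : InnerProductSpace ℂ H) (_ : CompleteSpace H)
      (ψ : H) (E : X → A → H →L[ℂ] H) (F : Y → B → H →L[ℂ] H),
      ‖ψ‖ = 1 ∧
      (∀ x, IsProjectiveMeasurement (E x)) ∧
      (∀ y, IsProjectiveMeasurement (F y)) ∧
      (∀ x y a b, Commute (E x a) (F y b)) ∧
      ∀ x y a b, (p x y a b : ℂ) = inner ℂ ψ (E x a (F y b ψ))}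

/-! ### Quality of the best affine model -/

/-- Infimum of `∑ |wᵢ|` over all finite decompositions `p = ∑ wᵢ pᵢ` with real `wᵢ` and `pᵢ ∈ S`
(`⊤` if there is none). -/
def affineCost {X Y A B : Type*} (S : Set (Behavior X Y A B)) (p : Behavior X Y A B) : EReal :=
  sInf {r | ∃ (n : ℕ) (w : Fin n → ℝ) (P : Fin n → Behavior X Y A B),
    (∀ i, P i ∈ S) ∧ p = ∑ i, w i • P i ∧ r = ((∑ i, |w i| : ℝ) : EReal)}

def nuTilde {X Y A B : Type*} [DecidableEq A] [DecidableEq B] (p : Behavior X Y A B) : EReal :=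
  affineCost (localSet X Y A B) p

def gammaTwoTilde {X Y A B : Type*} [Fintype A] [Fintype B] (p : Behavior X Y A B) : EReal :=
  affineCost (quantumSet X Y A B) p

/-! ### Classical communication with shared randomness -/

/-- Deterministic two-party protocol trees. At an inner node the owner sends one bit computed from
their input; at a leaf each player produces an outcome from their input. -/
inductive ProtocolTree (X Y A B : Type*) where
  | output (f : X → A) (g : Y → B) : ProtocolTree X Y A B
  | alice (m : X → Bool) (next : Bool → ProtocolTree X Y A B) : ProtocolTree X Y A B
  | bob (m : Y → Bool) (next : Bool → ProtocolTree X Y A B) : ProtocolTree X Y A B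

namespace ProtocolTree

/-- The pair of outcomes on inputs `x`, `y`. -/
def run {X Y A B : Type*} (x : X) (y : Y) : ProtocolTree X Y A B → A × B
  | output f g => (f x, g y)
  | alice m next => run x y (next (m x))
  | bob m next => run x y (next (m y))

/-- The number of bits exchanged in the worst case. -/
def depth {X Y A B : Type*} : ProtocolTree X Y A B → ℕ
  | output _ _ => 0
  | alice _ next => max (depth (next false)) (depth (next true)) + 1
  | bob _ next => max (depth (next false)) (depth (next true)) + 1

end ProtocolTree

/-- `p` is produced exactly by a public-coin protocol with at most `t` bits of communication. The
shared random string is a point `ω` of an arbitrary probability space; private coins are part of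
`ω`. -/
def SimulableWithBits {X Y A B : Type*} (p : Behavior X Y A B) (t : ℕ) : Prop :=
  ∃ (Ω : Type) (_ : MeasurableSpace Ω) (μ : Measure Ω) (_ : IsProbabilityMeasure μ)
    (T : Ω → ProtocolTree X Y A B),
    (∀ ω, (T ω).depth ≤ t) ∧
    ∀ x y a b, MeasurableSet {ω | (T ω).run x y = (a, b)} ∧
      p x y a b = μ.real {ω | (T ω).run x y = (a, b)}

/-- Public-coin communication complexity of simulating `p` exactly (`⊤` if impossible). -/
def publicCoinComplexity {X Y A B : Type*} (p : Behavior X Y A B) : ℕ∞ :=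
  sInf {c | ∃ t : ℕ, c = t ∧ SimulableWithBits p t}

/-! ### Quantum communication with shared entanglement -/

inductive Party where
  | alice
  | bob

def Party.other : Party → Party
  | .alice => .bob
  | .bob => .alice

/-- A Hilbert space `H` that holds an entangled system shared by the two players, and `q` message
qubits. Consistently with the definition of quantum distributions, locality is expressed by
commutation: the operators on a player's part of the entangled system form a `*`-algebra
`base P`, the operators on message qubit `j` form a copy `qubit j` of the `2 × 2` matrices, and
operators on different parts commute. The tensor product model is the case
`H = H_A ⊗ (ℂ²)^{⊗q} ⊗ H_B` with `base alice = B(H_A)`, `base bob = B(H_B)`; the registers `H_A`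
and `H_B` may have any dimension and include the players' work space.

Message qubit `j` is the one sent in round `j`, by the player `sender j`. -/
structure MessageSystem (q : ℕ) (H : Type) [NormedAddCommGroup H] [InnerProductSpace ℂ H]
    [CompleteSpace H] where
  base : Party → StarSubalgebra ℂ (H →L[ℂ] H)
  qubit : Fin q → Matrix (Fin 2) (Fin 2) ℂ →⋆ₐ[ℂ] (H →L[ℂ] H)
  sender : Fin q → Party
  commute_base : ∀ S ∈ base .alice, ∀ T ∈ base .bob, Commute S T
  commute_base_qubit : ∀ P, ∀ S ∈ base P, ∀ j M, Commute S (qubit j M)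
  commute_qubit : ∀ i j, i ≠ j → ∀ M N, Commute (qubit i M) (qubit j N)

namespace MessageSystem

/-- The player who holds message qubit `j` after the first `k` transmissions. -/
def holder {q : ℕ} {H : Type} [NormedAddCommGroup H] [InnerProductSpace ℂ H] [CompleteSpace H]
    (M : MessageSystem q H) (k : ℕ) (j : Fin q) : Party :=
  if (j : ℕ) < k then (M.sender j).other else M.sender j

/-- The operators available to a player after the first `k` transmissions: those on the player's
part of the entangled system together with the message qubits that the player holds. -/
def localAlgebra {q : ℕ} {H : Type} [NormedAddCommGroup H] [InnerProductSpace ℂ H]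
    [CompleteSpace H] (M : MessageSystem q H) (P : Party) (k : ℕ) :
    StarSubalgebra ℂ (H →L[ℂ] H) :=
  StarAlgebra.adjoin ℂ
    ((M.base P : Set (H →L[ℂ] H)) ∪ {S | ∃ j, M.holder k j = P ∧ ∃ N, S = M.qubit j N})

end MessageSystem

/-- A protocol in which `q` qubits are sent, starting from an arbitrary shared state. In round
`k < q` each player applies a unitary, chosen according to the player's input, to the part of the
system that the player holds; then qubit `k` goes from its sender to the other player. After the
last round each player measures. -/
structure QuantumProtocol (X Y A B : Type*) [Fintype A] [Fintype B] (q : ℕ) (H : Type)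
    [NormedAddCommGroup H] [InnerProductSpace ℂ H] [CompleteSpace H]
    extends MessageSystem q H where
  init : H
  norm_init : ‖init‖ = 1
  unitaryA : ℕ → X → H →L[ℂ] H
  unitaryB : ℕ → Y → H →L[ℂ] H
  unitaryA_mem : ∀ k < q, ∀ x, unitaryA k x ∈ unitary (H →L[ℂ] H) ∧
    unitaryA k x ∈ toMessageSystem.localAlgebra .alice k
  unitaryB_mem : ∀ k < q, ∀ y, unitaryB k y ∈ unitary (H →L[ℂ] H) ∧
    unitaryB k y ∈ toMessageSystem.localAlgebra .bob k
  measA : X → A → H →L[ℂ] H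
  measB : Y → B → H →L[ℂ] H
  measA_proj : ∀ x, IsProjectiveMeasurement (measA x)
  measB_proj : ∀ y, IsProjectiveMeasurement (measB y)
  measA_mem : ∀ x a, measA x a ∈ toMessageSystem.localAlgebra .alice q
  measB_mem : ∀ y b, measB y b ∈ toMessageSystem.localAlgebra .bob q

namespace QuantumProtocol

/-- The joint state after `k` rounds on inputs `x`, `y`. -/
def state {X Y A B : Type*} [Fintype A] [Fintype B] {q : ℕ} {H : Type} [NormedAddCommGroup H]
    [InnerProductSpace ℂ H] [CompleteSpace H] (Q : QuantumProtocol X Y A B q H) (x : X) (y : Y) :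
    ℕ → H
  | 0 => Q.init
  | k + 1 => Q.unitaryA k x (Q.unitaryB k y (Q.state x y k))

end QuantumProtocol

/-- `p` is produced exactly by an entanglement-assisted protocol that sends `q` qubits. -/
def SimulableWithQubits {X Y A B : Type*} [Fintype A] [Fintype B] (p : Behavior X Y A B)
    (q : ℕ) : Prop :=
  ∃ (H : Type) (_ : NormedAddCommGroup H) (_ : InnerProductSpace ℂ H) (_ : CompleteSpace H)
    (Q : QuantumProtocol X Y A B q H),
    ∀ x y a b, (p x y a b : ℂ) =
      inner ℂ (Q.state x y q) (Q.measA x a (Q.measB y b (Q.state x y q)))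

/-- Entanglement-assisted quantum communication complexity of simulating `p` exactly
(`⊤` if impossible). -/
def entangledComplexity {X Y A B : Type*} [Fintype A] [Fintype B] (p : Behavior X Y A B) : ℕ∞ :=
  sInf {c | ∃ q : ℕ, c = q ∧ SimulableWithQubits p q}

end

noncomputable section

/-! ### Affine models -/

/-! Players who may not communicate can guess what they would have received and abort when the guess
fails. For `t` bits they guess the transcript: the `2 ^ t` transcripts cut the inputs into
rectangles and exactly one is consistent with `(x, y)`, so `p` is `2 ^ t` times the part of a local
strategy with aborts in which both accept (`SimulableWithBits.exists_partial_strategies`). For `q`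
qubits every transmission becomes teleportation through a fresh entangled pair, postselected on the
outcome that needs no correction. This costs amplitude `1 / 2`, hence probability `1 / 4`, per qubit
(`SimulableWithQubits.exists_postselected`).

Let `N` be `2 ^ t` or `4 ^ q`, and let `G` be `N` times the strategy with aborts. Replacing aborts
by fixed outcomes gives `N` times a local or quantum distribution, which exceeds `p` by the mass on
which somebody aborts. As `G` and `p` are both non-signaling, Alice's mass there with Bob aborting
depends on `x` only, and symmetrically for Bob. Hence the excess is a mixture of products of total
mass `N - 1`, and subtracting it gives cost `2 * N - 1` (`hasAffineModel_of_relabel`).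

For correlations with uniform marginals, an aborting player outputs a random sign instead. Then `C /
N` and `-C / N` are both attained, and `C` is an affine combination of them of cost `N`
(`hasAffineModel_ofCorrelation`). In the quantum case `N` improves to `2 ^ q`: Alice's observable,
conjugated by her acceptance operator, sends the shared state to a vector of norm at most `rA`,
Bob's to one of norm at most `rB`, with `rA * rB = 2 ^ (-q)`, while their inner product is `4 ^ (-q)
* C`. The rescaled vectors lie in the unit ball and have inner product `C / 2 ^ q`, which is a
quantum correlation by Tsirelson's theorem (`ofCorrelation_mem_quantumSet`). -/

/-- `p` is a finite real combination of elements of `S` with absolute weight at most `r`. -/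
def HasAffineModel {X Y A B : Type*} (S : Set (Behavior X Y A B)) (p : Behavior X Y A B)
    (r : ℝ) : Prop :=
  ∃ (n : ℕ) (w : Fin n → ℝ) (P : Fin n → Behavior X Y A B),
    (∀ i, P i ∈ S) ∧ p = ∑ i, w i • P i ∧ ∑ i, |w i| ≤ r

namespace HasAffineModel

variable {X Y A B : Type*} {S : Set (Behavior X Y A B)} {p p' : Behavior X Y A B} {r r' : ℝ}

theorem affineCost_le (h : HasAffineModel S p r) : affineCost S p ≤ (r : EReal) := by
  obtain ⟨n, w, P, hP, hp, hr⟩ := h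
  have : affineCost S p ≤ ((∑ i, |w i| : ℝ) : EReal) := sInf_le ⟨n, w, P, hP, hp, rfl⟩
  exact this.trans (EReal.coe_le_coe_iff.2 hr)

theorem mono (h : HasAffineModel S p r) (hr : r ≤ r') : HasAffineModel S p r' := by
  obtain ⟨n, w, P, hP, hp, h⟩ := h
  exact ⟨n, w, P, hP, hp, h.trans hr⟩

theorem zero : HasAffineModel S 0 0 :=
  ⟨0, 0, Fin.elim0, fun i => i.elim0, by simp, by simp⟩

theorem of_mem (h : p ∈ S) : HasAffineModel S p 1 :=
  ⟨1, 1, fun _ => p, fun _ => h, by simp, by simp⟩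

theorem add (h : HasAffineModel S p r) (h' : HasAffineModel S p' r') :
    HasAffineModel S (p + p') (r + r') := by
  obtain ⟨n, w, P, hP, rfl, hr⟩ := h
  obtain ⟨n', w', P', hP', rfl, hr'⟩ := h'
  refine ⟨n + n', Fin.append w w', Fin.append P P', fun i => ?_, ?_, ?_⟩
  · refine Fin.addCases (fun i => ?_) (fun i => ?_) i
    · simpa using hP i
    · simpa using hP' i
  · simp [Fin.sum_univ_add]
  · simpa [Fin.sum_univ_add] using add_le_add hr hr'

theorem smul (h : HasAffineModel S p r) (c : ℝ) : HasAffineModel S (c • p) (|c| * r) := by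
  obtain ⟨n, w, P, hP, rfl, hr⟩ := h
  refine ⟨n, fun i => c * w i, P, hP, ?_, ?_⟩
  · simp [Finset.smul_sum, smul_smul]
  · simp only [abs_mul, ← Finset.mul_sum]
    exact mul_le_mul_of_nonneg_left hr (abs_nonneg c)

theorem smul_of_nonneg (h : HasAffineModel S p r) {c : ℝ} (hc : 0 ≤ c) :
    HasAffineModel S (c • p) (c * r) := by
  simpa [abs_of_nonneg hc] using h.smul c

theorem sub (h : HasAffineModel S p r) (h' : HasAffineModel S p' r') :
    HasAffineModel S (p - p') (r + r') := by
  simpa [sub_eq_add_neg] using h.add (h'.smul (-1))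

theorem sum {ι : Type*} (s : Finset ι) {P : ι → Behavior X Y A B} {w : ι → ℝ}
    (h : ∀ i ∈ s, HasAffineModel S (P i) (w i)) :
    HasAffineModel S (∑ i ∈ s, P i) (∑ i ∈ s, w i) := by
  classical
  induction s using Finset.induction_on with
  | empty => simpa using zero
  | insert i s hi ih =>
    rw [Finset.sum_insert hi, Finset.sum_insert hi]
    exact (h i (Finset.mem_insert_self i s)).add
      (ih fun j hj => h j (Finset.mem_insert_of_mem hj))

end HasAffineModel

theorem IsNonSignaling.nonempty_outcomes {X Y A B : Type*} [Fintype A] [Fintype B] [Nonempty X]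
    [Nonempty Y] {p : Behavior X Y A B} (hp : IsNonSignaling p) : Nonempty (A × B) := by
  have h := hp.sum_eq_one (Classical.arbitrary X) (Classical.arbitrary Y)
  by_contra hne
  rcases isEmpty_prod.1 (not_nonempty_iff.1 hne) with _ | _ <;> simp at h

/-- `α x` is a probability distribution for every `x`. -/
structure IsStochastic {X A : Type*} [Fintype A] (α : X → A → ℝ) : Prop where
  nonneg : ∀ x a, 0 ≤ α x a
  sum_eq_one : ∀ x, ∑ a, α x a = 1

theorem isStochastic_ite {X A : Type*} [Fintype A] [DecidableEq A] (f : X → A) :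
    IsStochastic fun x a => if a = f x then (1 : ℝ) else 0 where
  nonneg x a := by split_ifs <;> norm_num
  sum_eq_one x := by simp

/-- The distribution in which the players sample independently. -/
def productBehavior {X Y A B : Type*} (α : X → A → ℝ) (β : Y → B → ℝ) : Behavior X Y A B :=
  fun x y a b => α x a * β y b

/-- All products of stochastic maps lie in `S`. -/
def ContainsProducts {X Y A B : Type*} [Fintype A] [Fintype B] (S : Set (Behavior X Y A B)) :
    Prop :=
  ∀ α β, IsStochastic α → IsStochastic β → productBehavior α β ∈ S

/-! ### Recovering a non-signaling distribution from a strategy with aborts. -/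

section Fallback

variable {X Y A B : Type*} [Fintype A] [Fintype B] {S : Set (Behavior X Y A B)}

theorem hasAffineModel_mul_left (hS : ContainsProducts S) {f : X → A → ℝ} {β : Y → B → ℝ}
    {s : ℝ} (hs : 0 ≤ s) (hf : ∀ x a, 0 ≤ f x a) (hfs : ∀ x, ∑ a, f x a = s)
    (hβ : IsStochastic β) : HasAffineModel S (productBehavior f β) s := by
  rcases hs.eq_or_lt with rfl | hs
  · have : productBehavior f β = 0 := by
      funext x y a b
      have := (Finset.sum_eq_zero_iff_of_nonneg fun a _ => hf x a).1 (hfs x) a (Finset.mem_univ a)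
      simp [productBehavior, this]
    rw [this]
    exact .zero
  · have h := (HasAffineModel.of_mem (hS (fun x a => f x a / s) β
      ⟨fun x a => div_nonneg (hf x a) hs.le, fun x => by
        rw [← Finset.sum_div, hfs, div_self hs.ne']⟩ hβ)).smul_of_nonneg hs.le
    rw [mul_one] at h
    convert h using 1
    funext x y a b
    simp only [productBehavior, Pi.smul_apply, smul_eq_mul]
    field_simp

theorem hasAffineModel_mul_right (hS : ContainsProducts S) {α : X → A → ℝ} {g : Y → B → ℝ}
    {s : ℝ} (hs : 0 ≤ s) (hg : ∀ y b, 0 ≤ g y b) (hgs : ∀ y, ∑ b, g y b = s)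
    (hα : IsStochastic α) : HasAffineModel S (productBehavior α g) s := by
  rcases hs.eq_or_lt with rfl | hs
  · have : productBehavior α g = 0 := by
      funext x y a b
      have := (Finset.sum_eq_zero_iff_of_nonneg fun b _ => hg y b).1 (hgs y) b (Finset.mem_univ b)
      simp [productBehavior, this]
    rw [this]
    exact .zero
  · have h := (HasAffineModel.of_mem (hS α (fun y b => g y b / s) hα
      ⟨fun y b => div_nonneg (hg y b) hs.le, fun y => by
        rw [← Finset.sum_div, hgs, div_self hs.ne']⟩)).smul_of_nonneg hs.le
    rw [mul_one] at h
    convert h using 1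
    funext x y a b
    simp only [productBehavior, Pi.smul_apply, smul_eq_mul]
    field_simp

variable [DecidableEq A] [DecidableEq B]

/-- The players never both deviate from the default outcomes `a₀`, `b₀`. -/
def residualBehavior (a₀ : A) (b₀ : B) (rA : X → A → ℝ) (rB : Y → B → ℝ) (N : ℝ) : Behavior X Y A B :=
  fun x y a b => (if b = b₀ then rA x a else 0) + (if a = a₀ then rB y b else 0) +
    if a = a₀ ∧ b = b₀ then N - ∑ a, rA x a - ∑ b, rB y b else 0

/-- Split `N` at the largest mass `s` of `rA`. With weight `s` Bob is fixed at `b₀` and Alice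
follows `rA`, her missing mass going to `a₀`; with weight `N - s` the roles are exchanged. The bound
at the maximizing input shows that `N - s` suffices for every `rB y`, and the two deficits add up to
the `(a₀, b₀)` term. -/
theorem hasAffineModel_residual [Finite X] [Nonempty X] [Nonempty Y] (hS : ContainsProducts S)
    (a₀ : A) (b₀ : B)
    {rA : X → A → ℝ} {rB : Y → B → ℝ} {N : ℝ} (hA : ∀ x a, 0 ≤ rA x a) (hB : ∀ y b, 0 ≤ rB y b)
    (hN : ∀ x y, ∑ a, rA x a + ∑ b, rB y b ≤ N) :
    HasAffineModel S (residualBehavior a₀ b₀ rA rB N) N := by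
  obtain ⟨x₀, hx₀⟩ := Finite.exists_max fun x => ∑ a, rA x a
  set s := ∑ a, rA x₀ a with hs
  have hs0 : 0 ≤ s := Finset.sum_nonneg fun a _ => hA x₀ a
  have hNs : ∀ y, ∑ b, rB y b ≤ N - s := fun y => by linarith [hN x₀ y]
  have hNs0 : 0 ≤ N - s :=
    (Finset.sum_nonneg fun b _ => hB (Classical.arbitrary Y) b).trans (hNs _)
  have h₁ := hasAffineModel_mul_left hS (f := fun x a => rA x a +
      if a = a₀ then s - ∑ a, rA x a else 0) hs0
    (fun x a => add_nonneg (hA x a) (by split_ifs <;> linarith [hx₀ x]))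
    (fun x => by simp [Finset.sum_add_distrib]) (isStochastic_ite fun _ : Y => b₀)
  have h₂ := hasAffineModel_mul_right hS (g := fun y b => rB y b +
      if b = b₀ then N - s - ∑ b, rB y b else 0) hNs0
    (fun y b => add_nonneg (hB y b) (by split_ifs <;> linarith [hNs y]))
    (fun y => by simp [Finset.sum_add_distrib]) (isStochastic_ite fun _ : X => a₀)
  convert h₁.add h₂ using 1
  · funext x y a b
    simp only [residualBehavior, productBehavior, Pi.add_apply]
    by_cases ha : a = a₀ <;> by_cases hb : b = b₀ <;> simp [ha, hb]
    ring
  · ring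

/-- Replacing the outcome `none` by `a₀` and `b₀` respectively. -/
def relabel (a₀ : A) (b₀ : B) (G : Behavior X Y (Option A) (Option B)) : Behavior X Y A B :=
  fun x y a b => ∑ o, ∑ o', if o.getD a₀ = a ∧ o'.getD b₀ = b then G x y o o' else 0

/-- `relabel a₀ b₀ G` counts `p` plus the events in which somebody aborts. Those events form a
`residualBehavior` of mass `N - 1`, so their subtraction raises the cost from `N` to `2 * N - 1`. -/
theorem hasAffineModel_of_relabel [Finite X] [Nonempty X] [Nonempty Y] (hS : ContainsProducts S)
    {p : Behavior X Y A B} (hp : IsNonSignaling p) (a₀ : A) (b₀ : B) {N : ℝ}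
    {G : Behavior X Y (Option A) (Option B)} (hG : ∀ x y o o', 0 ≤ G x y o o')
    (hsum : ∀ x y, ∑ o, ∑ o', G x y o o' = N)
    (hGA : ∀ o x y y', ∑ o', G x y o o' = ∑ o', G x y' o o')
    (hGB : ∀ o' x x' y, ∑ o, G x y o o' = ∑ o, G x' y o o')
    (hpG : ∀ x y a b, p x y a b = G x y (some a) (some b))
    (h : HasAffineModel S (relabel a₀ b₀ G) N) : HasAffineModel S p (2 * N - 1) := by
  obtain ⟨x₀⟩ := ‹Nonempty X›
  obtain ⟨y₀⟩ := ‹Nonempty Y›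
  have : Nonempty X := ⟨x₀⟩
  have : Nonempty Y := ⟨y₀⟩
  -- This entry is the marginal of `G` at `some a` minus the marginal of `p` at `a`; neither depends
  -- on `y`.
  have hA : ∀ x y a, G x y (some a) none = G x y₀ (some a) none := fun x y a => by
    have h₁ := hGA (some a) x y y₀
    have h₂ := hp.marginal_alice a x y y₀
    simp only [Fintype.sum_option, hpG] at h₁ h₂
    linarith
  have hB : ∀ x y b, G x y none (some b) = G x₀ y none (some b) := fun x y b => by
    have h₁ := hGB (some b) x x₀ y
    have h₂ := hp.marginal_bob b x x₀ y
    simp only [Fintype.sum_option, hpG] at h₁ h₂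
    linarith
  have hnone : ∀ x y, G x y none none =
      N - 1 - ∑ a, G x y₀ (some a) none - ∑ b, G x₀ y none (some b) := fun x y => by
    have h₁ := hsum x y
    have h₂ := hp.sum_eq_one x y
    simp only [Fintype.sum_option, Finset.sum_add_distrib, ← hpG, h₂, hA x y, hB x y] at h₁
    linarith
  have hR := hasAffineModel_residual hS a₀ b₀ (rA := fun x a => G x y₀ (some a) none)
    (rB := fun y b => G x₀ y none (some b)) (N := N - 1) (fun x a => hG _ _ _ _)
    (fun y b => hG _ _ _ _) (fun x y => by linarith [hG x y none none, hnone x y])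
  convert h.sub hR using 1
  · funext x y a b
    simp only [relabel, residualBehavior, Pi.sub_apply, Fintype.sum_option, Option.getD_none,
      Option.getD_some, Finset.sum_add_distrib, hA x y, hB x y, hnone x y, ← hpG, ite_and]
    simp [eq_comm]
    ring
  · ring

end Fallback

/-- The coefficients `(N + 1) / 2` and `-(N - 1) / 2` add up to `1`, which preserves the uniform
part, while their absolute values add up to `N`, which turns `±C / N` back into `C`. -/
theorem hasAffineModel_ofCorrelation {X Y : Type*} {S : Set (Behavior X Y ℤˣ ℤˣ)}
    {C : X → Y → ℝ} {N : ℝ} (hN : 1 ≤ N) (h : ofCorrelation (fun x y => C x y / N) ∈ S)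
    (h' : ofCorrelation (fun x y => -C x y / N) ∈ S) :
    HasAffineModel S (ofCorrelation C) N := by
  have h₁ := (HasAffineModel.of_mem h).smul_of_nonneg (c := (N + 1) / 2) (by linarith)
  have h₂ := (HasAffineModel.of_mem h').smul_of_nonneg (c := (N - 1) / 2) (by linarith)
  convert h₁.sub h₂ using 1
  · funext x y a b
    simp only [ofCorrelation, Pi.sub_apply, Pi.smul_apply, smul_eq_mul]
    field_simp
    ring
  · ring

/-! ### Classical protocols -/

section Local

variable {X Y A B : Type*}

/-- If the answers to all inputs are sampled in advance and independently, the answer to `x` has law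
`α x`, because the factors at the other inputs sum to `1`. -/
theorem sum_prod_ite_eq [Fintype X] [DecidableEq X] [Fintype A] [DecidableEq A]
    {α : X → A → ℝ} (hα : IsStochastic α) (x : X) (a : A) :
    ∑ f : X → A, (∏ x', α x' (f x')) * (if a = f x then 1 else 0) = α x a := by
  have h : ∀ f : X → A, (∏ x', α x' (f x')) * (if a = f x then 1 else 0) =
      ∏ x', α x' (f x') * (if x' = x then (if a = f x' then 1 else 0) else 1) := fun f => by
    rw [Finset.prod_mul_distrib, Finset.prod_ite_eq' Finset.univ x]
    simp
  simp_rw [h]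
  rw [← Fintype.prod_sum fun x' a' => α x' a' * (if x' = x then (if a = a' then 1 else 0) else 1),
    Finset.prod_eq_single x]
  · simp
  · intro x' _ hx'
    simp [hx', hα.sum_eq_one]
  · simp

theorem containsProducts_localSet [Finite X] [Finite Y] [Fintype A] [Fintype B] [DecidableEq A]
    [DecidableEq B] : ContainsProducts (localSet X Y A B) := by
  classical
  intro α β hα hβ
  have := Fintype.ofFinite X
  have := Fintype.ofFinite Y
  have h : productBehavior α β = ∑ i : (X → A) × (Y → B),
      ((∏ x, α x (i.1 x)) * ∏ y, β y (i.2 y)) • localDeterministic i.1 i.2 := by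
    funext x y a b
    simp only [productBehavior, Finset.sum_apply, Pi.smul_apply, smul_eq_mul,
      Fintype.sum_prod_type, localDeterministic]
    rw [← sum_prod_ite_eq hα x a, ← sum_prod_ite_eq hβ y b, Finset.sum_mul_sum]
    refine Finset.sum_congr rfl fun f _ => Finset.sum_congr rfl fun g _ => ?_
    split_ifs <;> simp_all
  rw [h]
  refine (convex_convexHull ℝ _).sum_mem (fun i _ => ?_) ?_ fun i _ =>
    subset_convexHull ℝ _ ⟨i.1, i.2, rfl⟩
  · exact mul_nonneg (Finset.prod_nonneg fun x _ => hα.nonneg _ _)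
      (Finset.prod_nonneg fun y _ => hβ.nonneg _ _)
  · rw [Fintype.sum_prod_type]
    simp only
    rw [← Finset.sum_mul_sum, ← Fintype.prod_sum, ← Fintype.prod_sum]
    simp [hα.sum_eq_one, hβ.sum_eq_one]

theorem localDeterministic_mem [DecidableEq A] [DecidableEq B] (f : X → A) (g : Y → B) :
    localDeterministic f g ∈ localSet X Y A B :=
  subset_convexHull ℝ _ ⟨f, g, rfl⟩

end Local

/-- A deterministic protocol partitions the inputs into `2 ^ t` rectangles, indexed by transcripts;
`none` means that the transcript is inconsistent with the input. -/
theorem ProtocolTree.exists_rectangles {X Y A B : Type*} (T : ProtocolTree X Y A B) {t : ℕ}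
    (hT : T.depth ≤ t) : ∃ (f : (Fin t → Bool) → X → Option A) (g : (Fin t → Bool) → Y → Option B),
      ∀ x y, ∃ u₀, f u₀ x = some (T.run x y).1 ∧ g u₀ y = some (T.run x y).2 ∧
        ∀ u ≠ u₀, f u x = none ∨ g u y = none := by
  induction T generalizing t with
  | output f g =>
    -- A leaf reached early pads its transcript with `false`. Alice alone rejects any other padding,
    -- so that no transcript is counted twice.
    refine ⟨fun u x => if u = fun _ => false then some (f x) else none,
      fun _ y => some (g y), fun x y => ⟨fun _ => false, by simp [run], by simp [run], ?_⟩⟩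
    intro u hu
    simp [hu]
  | alice m next ih =>
    obtain _ | t := t
    · simp [depth] at hT
    have hd : ∀ c, (next c).depth ≤ t := by
      simp only [depth, add_le_add_iff_right, max_le_iff] at hT
      exact Bool.forall_bool.2 hT
    choose f g hfg using fun c => ih c (hd c)
    -- Only the speaker can check the first guessed bit; the listener follows the guess.
    refine ⟨fun u x => if u 0 = m x then f (u 0) (Fin.tail u) x else none,
      fun u y => g (u 0) (Fin.tail u) y, fun x y => ?_⟩
    obtain ⟨u₀, h₁, h₂, h₃⟩ := hfg (m x) x y
    refine ⟨Fin.cons (m x) u₀, by simpa [run] using h₁, by simpa [run] using h₂, fun u hu => ?_⟩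
    by_cases hm : u 0 = m x
    · have : Fin.tail u ≠ u₀ := fun h => hu (by rw [← h, ← hm, Fin.cons_self_tail])
      simpa [hm] using h₃ _ this
    · simp [hm]
  | bob m next ih =>
    obtain _ | t := t
    · simp [depth] at hT
    have hd : ∀ c, (next c).depth ≤ t := by
      simp only [depth, add_le_add_iff_right, max_le_iff] at hT
      exact Bool.forall_bool.2 hT
    choose f g hfg using fun c => ih c (hd c)
    refine ⟨fun u x => f (u 0) (Fin.tail u) x,
      fun u y => if u 0 = m y then g (u 0) (Fin.tail u) y else none, fun x y => ?_⟩
    obtain ⟨u₀, h₁, h₂, h₃⟩ := hfg (m y) x y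
    refine ⟨Fin.cons (m y) u₀, by simpa [run] using h₁, by simpa [run] using h₂, fun u hu => ?_⟩
    by_cases hm : u 0 = m y
    · have : Fin.tail u ≠ u₀ := fun h => hu (by rw [← h, ← hm, Fin.cons_self_tail])
      simpa [hm] using h₃ _ this
    · simp [hm]

section Simulable

variable {X Y A B : Type*} [Finite X] [Finite Y] [Fintype A] [Fintype B] [DecidableEq A]
  [DecidableEq B]

/-- The shared randomness may be taken finite: only the table of outcomes matters. -/
theorem SimulableWithBits.exists_finite {p : Behavior X Y A B} {t : ℕ}
    (h : SimulableWithBits p t) :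
    ∃ (n : ℕ) (w : Fin n → ℝ) (T : Fin n → ProtocolTree X Y A B),
      (∀ i, 0 ≤ w i) ∧ ∑ i, w i = 1 ∧ (∀ i, (T i).depth ≤ t) ∧
      ∀ x y a b, p x y a b = ∑ i, w i * if (T i).run x y = (a, b) then 1 else 0 := by
  classical
  obtain ⟨Ω, _, μ, _, T, hT, hp⟩ := h
  have := Fintype.ofFinite X
  have := Fintype.ofFinite Y
  have : Nonempty Ω := nonempty_of_isProbabilityMeasure μ
  let F : Ω → X → Y → A × B := fun ω x y => (T ω).run x y
  have hF : ∀ r, MeasurableSet (F ⁻¹' {r}) := fun r => by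
    have : F ⁻¹' {r} = ⋂ x, ⋂ y, {ω | (T ω).run x y = ((r x y).1, (r x y).2)} := by
      ext ω
      simp [F, funext_iff]
    rw [this]
    exact .iInter fun x => .iInter fun y => (hp x y _ _).1
  have hsum : ∀ s : Finset (X → Y → A × B),
      ∑ r ∈ s, μ.real (F ⁻¹' {r}) = μ.real (F ⁻¹' s) := fun s => by
    rw [← measureReal_biUnion_finset (fun r _ r' _ hr => ?_) fun r _ => hF r]
    · congr 1
      ext ω
      simp
    · exact Disjoint.preimage F (by simpa using hr)
  let e := (Fintype.equivFin (X → Y → A × B)).symm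
  -- One tree represents each table of outcomes. A table that never occurs has weight zero, so the
  -- choice made for it is harmless.
  let T' : (X → Y → A × B) → ProtocolTree X Y A B := fun r =>
    if hr : ∃ ω, F ω = r then T hr.choose else T (Classical.arbitrary Ω)
  refine ⟨_, fun i => μ.real (F ⁻¹' {e i}), fun i => T' (e i), fun i => measureReal_nonneg, ?_,
    fun i => ?_, fun x y a b => ?_⟩
  · rw [e.sum_comp fun r => μ.real (F ⁻¹' {r}), hsum]
    simp
  · simp only [T']
    split_ifs
    exacts [hT _, hT _]
  · rw [e.sum_comp fun r => μ.real (F ⁻¹' {r}) * if (T' r).run x y = (a, b) then 1 else 0,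
      (hp x y a b).2]
    have h₁ : ∀ r, μ.real (F ⁻¹' {r}) * (if (T' r).run x y = (a, b) then 1 else 0) =
        if r x y = (a, b) then μ.real (F ⁻¹' {r}) else 0 := fun r => by
      by_cases hr : ∃ ω, F ω = r
      · have : (T' r).run x y = r x y := by
          simp only [T', hr, dif_pos]
          exact congrFun (congrFun hr.choose_spec x) y
        simp [this]
      · have : F ⁻¹' {r} = ∅ := by
          ext ω
          simpa using fun h => hr ⟨ω, h⟩
        simp [this]
    simp_rw [h₁]
    rw [← Finset.sum_filter, hsum]
    congr 1
    ext ω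
    simp [F]

/-- An exact protocol writes `p` as a nonnegative combination, of weight `2 ^ t`, of local
deterministic strategies in which the players may abort. -/
theorem SimulableWithBits.exists_partial_strategies {p : Behavior X Y A B} {t : ℕ}
    (h : SimulableWithBits p t) :
    ∃ (n : ℕ) (w : Fin n × (Fin t → Bool) → ℝ) (f : Fin n × (Fin t → Bool) → X → Option A)
      (g : Fin n × (Fin t → Bool) → Y → Option B),
      (∀ i, 0 ≤ w i) ∧ ∑ i, w i = 2 ^ t ∧
      ∀ x y a b, p x y a b =
        ∑ i, w i * if some a = f i x ∧ some b = g i y then 1 else 0 := by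
  obtain ⟨n, w, T, hw, hsum, hT, hp⟩ := h.exists_finite
  choose f g hfg using fun i => (T i).exists_rectangles (hT i)
  -- Each of the `2 ^ t` transcripts receives the full weight of its tree, undivided: this is where
  -- the total `2 ^ t` comes from.
  refine ⟨n, fun i => w i.1, fun i => f i.1 i.2, fun i => g i.1 i.2, fun i => hw i.1, ?_,
    fun x y a b => ?_⟩
  · simp [Fintype.sum_prod_type, ← Finset.mul_sum, hsum]
  · rw [hp, Fintype.sum_prod_type]
    refine Finset.sum_congr rfl fun i _ => ?_
    dsimp only
    rw [← Finset.mul_sum]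
    congr 1
    obtain ⟨u₀, h₁, h₂, h₃⟩ := hfg i x y
    rw [Finset.sum_eq_single u₀]
    · simp only [h₁, h₂, Option.some.injEq, Prod.ext_iff, eq_comm]
    · intro u _ hu
      rcases h₃ u hu with h | h <;> simp [h]
    · simp

/-- With `none` replaced by a default outcome, each partial strategy becomes a deterministic local
one, so the relabelled family costs the total weight `N = 2 ^ t`. -/
theorem SimulableWithBits.hasAffineModel [Nonempty X] [Nonempty Y] {p : Behavior X Y A B}
    (hp : IsNonSignaling p) {t : ℕ} (h : SimulableWithBits p t) :
    HasAffineModel (localSet X Y A B) p (2 ^ (t + 1) - 1) := by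
  obtain ⟨n, w, f, g, hw, hsum, hpG⟩ := h.exists_partial_strategies
  obtain ⟨a₀, b₀⟩ := hp.nonempty_outcomes
  have := hasAffineModel_of_relabel containsProducts_localSet hp a₀ b₀ (N := 2 ^ t)
    (G := fun x y o o' => ∑ i, w i * if o = f i x ∧ o' = g i y then 1 else 0)
    (fun x y o o' => Finset.sum_nonneg fun i _ => mul_nonneg (hw i) (by split_ifs <;> norm_num))
    (fun x y => ?_) (fun o x y y' => ?_) (fun o' x x' y => ?_) hpG ?_
  · rwa [← pow_succ'] at this
  · simp_rw [Finset.sum_comm (t := Finset.univ (α := Fin n × (Fin t → Bool))), ← Finset.mul_sum,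
      ite_and]
    simp [hsum]
  · simp_rw [Finset.sum_comm (t := Finset.univ (α := Fin n × (Fin t → Bool))), ← Finset.mul_sum,
      ite_and]
    simp
  · simp_rw [Finset.sum_comm (t := Finset.univ (α := Fin n × (Fin t → Bool))), ← Finset.mul_sum,
      ite_and]
    simp
  · rw [← hsum]
    convert HasAffineModel.sum Finset.univ fun i _ => (HasAffineModel.of_mem
      (localDeterministic_mem (fun x => (f i x).getD a₀)
        fun y => (g i y).getD b₀)).smul_of_nonneg (hw i) using 1
    · funext x y a b
      simp only [relabel, Finset.sum_apply, Pi.smul_apply, localDeterministic, smul_eq_mul]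
      have : ∀ o o', (if o.getD a₀ = a ∧ o'.getD b₀ = b then
          ∑ i, w i * (if o = f i x ∧ o' = g i y then 1 else 0) else 0) =
          ∑ i, w i * if o = f i x then if o' = g i y then
            (if a = o.getD a₀ ∧ b = o'.getD b₀ then 1 else 0) else 0 else 0 := fun o o' => by
        simp only [eq_comm (a := a), eq_comm (a := b)]
        split_ifs <;> simp [ite_and]
      simp_rw [this, Finset.sum_comm (t := Finset.univ (α := Fin n × (Fin t → Bool))),
        ← Finset.mul_sum]
      simp
    · simp

end Simulable

/-! ### Correlations produced by classical protocols. -/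

theorem isStochastic_sign {X : Type*} {F : X → ℝ} (hF : ∀ x, |F x| ≤ 1) :
    IsStochastic fun x (a : ℤˣ) => (1 + ((a : ℤ) : ℝ) * F x) / 2 where
  nonneg x a := by
    have := abs_le.1 (hF x)
    rcases Int.units_eq_one_or a with rfl | rfl <;> simp <;> linarith
  sum_eq_one x := by
    simp [UnitsInt.univ]
    ring

/-- Independent signs with means `F x` and `G y` have the right correlation. Flipping both signs
with a shared fair coin keeps it and makes the marginals uniform. -/
theorem ofCorrelation_mul_mem_localSet {X Y : Type*} [Finite X] [Finite Y] {F : X → ℝ} {G : Y → ℝ}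
    (hF : ∀ x, |F x| ≤ 1) (hG : ∀ y, |G y| ≤ 1) :
    ofCorrelation (fun x y => F x * G y) ∈ localSet X Y ℤˣ ℤˣ := by
  have h₁ := containsProducts_localSet _ _ (isStochastic_sign hF) (isStochastic_sign hG)
  have h₂ := containsProducts_localSet _ _ (isStochastic_sign (F := -F) (by simpa using hF))
    (isStochastic_sign (F := -G) (by simpa using hG))
  have hc : Convex ℝ (localSet X Y ℤˣ ℤˣ) := convex_convexHull ℝ _
  convert hc h₁ h₂ (a := 1 / 2) (b := 1 / 2) (by norm_num) (by norm_num) (by norm_num) using 1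
  funext x y a b
  simp only [ofCorrelation, productBehavior, Pi.add_apply, Pi.smul_apply, Pi.neg_apply, smul_eq_mul]
  ring

theorem sum_ofCorrelation {X Y : Type*} (C : X → Y → ℝ) (x : X) (y : Y) :
    ∑ a : ℤˣ, ∑ b : ℤˣ, ((a : ℤ) : ℝ) * ((b : ℤ) : ℝ) * ofCorrelation C x y a b = C x y := by
  simp [UnitsInt.univ, ofCorrelation]
  ring

/-- An aborting player outputs a uniform sign, that is, one of mean `0`, so aborts contribute
nothing to the correlation. Normalizing the weights by `2 ^ t` leaves `C / 2 ^ t`. -/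
theorem SimulableWithBits.hasAffineModel_ofCorrelation {X Y : Type*} [Finite X] [Finite Y]
    {C : X → Y → ℝ} {t : ℕ} (h : SimulableWithBits (ofCorrelation C) t) :
    HasAffineModel (localSet X Y ℤˣ ℤˣ) (ofCorrelation C) (2 ^ t) := by
  obtain ⟨n, w, f, g, hw, hsum, hp⟩ := h.exists_partial_strategies
  let v : Option ℤˣ → ℝ := fun o => o.elim 0 fun a => ((a : ℤ) : ℝ)
  have hv : ∀ o, |v o| ≤ 1 := by
    rintro (_ | a)
    · simp [v]
    · rcases Int.units_eq_one_or a with rfl | rfl <;> simp [v]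
  have hvs : ∀ o : Option ℤˣ, ∑ a : ℤˣ, (if some a = o then ((a : ℤ) : ℝ) else 0) = v o := by
    rintro (_ | a)
    · simp [v]
    · simp only [Option.some.injEq]
      rw [Finset.sum_ite_eq' Finset.univ a, if_pos (Finset.mem_univ a)]
      rfl
  have hC : ∀ x y, C x y = ∑ i, w i * (v (f i x) * v (g i y)) := fun x y => by
    rw [← sum_ofCorrelation C x y]
    simp_rw [hp, Finset.mul_sum,
      Finset.sum_comm (t := Finset.univ (α := Fin n × (Fin t → Bool)))]
    refine Finset.sum_congr rfl fun i _ => ?_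
    rw [← hvs, ← hvs, Finset.sum_mul_sum, Finset.mul_sum]
    refine Finset.sum_congr rfl fun a _ => ?_
    rw [Finset.mul_sum]
    refine Finset.sum_congr rfl fun b _ => ?_
    split_ifs <;> simp_all
    ring
  -- The factor `s` treats `C` and `-C` together; only `s = 1` and `s = -1` are used.
  have key : ∀ s : ℝ, |s| ≤ 1 →
      ofCorrelation (fun x y => s * C x y / 2 ^ t) ∈ localSet X Y ℤˣ ℤˣ := fun s hs => by
    have e : ofCorrelation (fun x y => s * C x y / 2 ^ t) = ∑ i, (w i / 2 ^ t) •
        ofCorrelation (fun x y => s * v (f i x) * v (g i y)) := by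
      funext x y a b
      have hone : ∑ i, w i / 2 ^ t = 1 := by
        rw [← Finset.sum_div, hsum, div_self (by positivity)]
      simp only [ofCorrelation, Finset.sum_apply, Pi.smul_apply, smul_eq_mul]
      have : ∀ i, w i / 2 ^ t * ((1 + ((a : ℤ) : ℝ) * ((b : ℤ) : ℝ) *
          (s * v (f i x) * v (g i y))) / 4) = w i / 2 ^ t * (1 / 4) +
          w i * (v (f i x) * v (g i y)) * (((a : ℤ) : ℝ) * ((b : ℤ) : ℝ) * s / 2 ^ t / 4) :=
        fun i => by ring
      simp_rw [this]
      rw [Finset.sum_add_distrib, ← Finset.sum_mul, ← Finset.sum_mul, hone, ← hC]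
      ring
    rw [e]
    refine (convex_convexHull ℝ _).sum_mem (fun i _ => div_nonneg (hw i) (by positivity)) ?_
      fun i _ => ofCorrelation_mul_mem_localSet (fun x => ?_) fun y => hv _
    · rw [← Finset.sum_div, hsum, div_self (by positivity)]
    · rw [abs_mul]
      exact mul_le_one₀ hs (abs_nonneg _) (hv _)
  refine _root_.hasAffineModel_ofCorrelation (one_le_pow₀ one_le_two) ?_ ?_
  · simpa using key 1 (by simp)
  · simpa using key (-1) (by simp)

/-! ### Block operators -/

section BlockOperators

/-- The direct sum of copies of `H` indexed by `ι`. -/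
abbrev HilbertPower (ι H : Type) : Type := PiLp 2 fun _ : ι => H

variable {ι H : Type} [Fintype ι] [NormedAddCommGroup H] [InnerProductSpace ℂ H]

/-- The operator on a direct sum of copies of `H` with a given matrix of blocks. -/
def blockMap (M : Matrix ι ι (H →L[ℂ] H)) : HilbertPower ι H →L[ℂ] HilbertPower ι H :=
  ((PiLp.continuousLinearEquiv 2 ℂ fun _ : ι => H).symm : (ι → H) →L[ℂ] HilbertPower ι H) ∘L
    ContinuousLinearMap.pi fun i => ∑ j, M i j ∘L PiLp.proj 2 (fun _ : ι => H) j

@[simp]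
theorem blockMap_apply (M : Matrix ι ι (H →L[ℂ] H)) (v : HilbertPower ι H) (i : ι) :
    blockMap M v i = ∑ j, M i j (v j) := by
  simp [blockMap]

/-- The isometry `v ↦ v ⊗ c` for a unit vector `c`. -/
def tensorIsometry (c : ι → ℂ) (hc : ∑ i, ‖c i‖ ^ 2 = 1) : H →ₗᵢ[ℂ] HilbertPower ι H :=
  LinearMap.isometryOfInner
    { toFun := fun v => WithLp.toLp 2 fun i => c i • v
      map_add' := fun v w => by
        ext i
        simp
      map_smul' := fun a v => by
        ext i
        exact smul_comm _ _ _ } fun v w => by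
    have h : ∀ i, c i * (starRingEnd ℂ) (c i) = ((‖c i‖ ^ 2 : ℝ) : ℂ) := fun i => by
      rw [RCLike.mul_conj]
      simp
    simp only [PiLp.inner_apply, LinearMap.coe_mk, AddHom.coe_mk, inner_smul_left,
      inner_smul_right, ← mul_assoc, h]
    rw [← Finset.sum_mul, ← Complex.ofReal_sum, hc]
    simp

@[simp]
theorem tensorIsometry_apply (c : ι → ℂ) (hc : ∑ i, ‖c i‖ ^ 2 = 1) (v : H) (i : ι) :
    tensorIsometry c hc v i = c i • v := rfl

variable [DecidableEq ι]

/-- The inclusion of a summand. -/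
def blockInclusion (i : ι) : H →ₗᵢ[ℂ] HilbertPower ι H :=
  tensorIsometry (Pi.single i 1) (by simp [Pi.single_apply, apply_ite, ite_pow])

theorem blockInclusion_apply (i : ι) (v : H) (j : ι) :
    blockInclusion i v j = if j = i then v else 0 := by
  simp [blockInclusion, Pi.single_apply]

variable [CompleteSpace H]

variable (ι H) in
/-- Matrices of operators act on a direct sum of copies of `H`. -/
def blockOp : Matrix ι ι (H →L[ℂ] H) →⋆ₐ[ℂ] (HilbertPower ι H →L[ℂ] HilbertPower ι H) where
  toFun := blockMap
  map_one' := by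
    ext v i
    simp [Matrix.one_apply, apply_ite, ite_apply]
  map_mul' M N := by
    ext v i
    simp only [blockMap_apply, Matrix.mul_apply, sum_apply, map_sum,
      ContinuousLinearMap.mul_def, ContinuousLinearMap.comp_apply]
    rw [Finset.sum_comm]
  map_zero' := by
    ext v i
    simp
  map_add' M N := by
    ext v i
    simp [Finset.sum_add_distrib]
  commutes' c := by
    ext v i
    rw [blockMap_apply, Finset.sum_eq_single i]
    · simp [Matrix.algebraMap_matrix_apply, Algebra.algebraMap_eq_smul_one]
    · intro j _ hj
      simp [Matrix.algebraMap_matrix_apply, hj.symm]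
    · simp
  map_star' M := by
    rw [ContinuousLinearMap.star_eq_adjoint, ContinuousLinearMap.eq_adjoint_iff]
    intro v w
    simp [PiLp.inner_apply, Matrix.star_apply, sum_inner, inner_sum,
      ContinuousLinearMap.star_eq_adjoint, ContinuousLinearMap.adjoint_inner_left]
    rw [Finset.sum_comm]

theorem blockOp_apply (M : Matrix ι ι (H →L[ℂ] H)) (v : HilbertPower ι H) (i : ι) :
    blockOp ι H M v i = ∑ j, M i j (v j) := blockMap_apply M v i

variable (ι H) in
/-- The diagonal action of the operators on `H`. -/
def amplify : (H →L[ℂ] H) →⋆ₐ[ℂ] (HilbertPower ι H →L[ℂ] HilbertPower ι H) :=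
  (blockOp ι H).comp
    { Matrix.scalarAlgHom ι ℂ with
      map_star' := fun T => by
        simp [Matrix.star_eq_conjTranspose, Matrix.scalar_apply, Matrix.diagonal_conjTranspose] }

theorem amplify_eq (T : H →L[ℂ] H) : amplify ι H T = blockOp ι H (Matrix.diagonal fun _ => T) := rfl

theorem amplify_apply (T : H →L[ℂ] H) (v : HilbertPower ι H) (i : ι) :
    amplify ι H T v i = T (v i) := by
  rw [amplify_eq, blockOp_apply, Finset.sum_eq_single i]
  · simp
  · intro j _ hj
    simp [Matrix.diagonal_apply_ne' _ hj]
  · simp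

theorem amplify_blockInclusion (T : H →L[ℂ] H) (i : ι) (v : H) :
    amplify ι H T (blockInclusion i v) = blockInclusion i (T v) := by
  ext j
  rw [amplify_apply, blockInclusion_apply, blockInclusion_apply]
  split_ifs <;> simp

theorem commute_amplify_blockOp {T : H →L[ℂ] H} {M : Matrix ι ι (H →L[ℂ] H)}
    (h : ∀ i j, Commute T (M i j)) : Commute (amplify ι H T) (blockOp ι H M) := by
  rw [amplify_eq]
  refine Commute.map ?_ (blockOp ι H)
  ext i j : 1
  rw [Matrix.diagonal_mul, Matrix.mul_diagonal]
  exact h i j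

theorem inner_blockInclusion_blockOp (M : Matrix ι ι (H →L[ℂ] H)) (i : ι) (v w : H) :
    inner ℂ (blockInclusion i v) (blockOp ι H M (blockInclusion i w)) = inner ℂ v (M i i w) := by
  rw [PiLp.inner_apply, Finset.sum_eq_single i]
  · rw [blockOp_apply, Finset.sum_eq_single i]
    · simp [blockInclusion_apply]
    · intro j _ hj
      simp [blockInclusion_apply, hj]
    · simp
  · intro j _ hj
    simp [blockInclusion_apply, hj]
  · simp

end BlockOperators

/-! ### Dilation of measurements -/

section Dilation

variable {R : Type*} [Ring R] {n : ℕ}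

/-- The self-adjoint unitary extending the isometry with components `s i`. -/
def dilationUnitary (s : Fin n → R) : Matrix (Unit ⊕ Fin n) (Unit ⊕ Fin n) R :=
  Matrix.fromBlocks 0 (Matrix.of fun _ j => s j) (Matrix.of fun i _ => s i)
    (1 - Matrix.of fun i j => s i * s j)

theorem star_dilationUnitary [StarRing R] {s : Fin n → R} (hs : ∀ i, star (s i) = s i) :
    star (dilationUnitary s) = dilationUnitary s := by
  rw [dilationUnitary, Matrix.star_eq_conjTranspose, Matrix.fromBlocks_conjTranspose]
  congr 1
  · simp
  · ext i j; simp [hs]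
  · ext i j; simp [hs]
  · ext i j
    rw [Matrix.conjTranspose_sub, Matrix.conjTranspose_one]
    simp [hs]

theorem dilationUnitary_mul_self {s : Fin n → R} (hs : ∑ i, s i * s i = 1) :
    dilationUnitary s * dilationUnitary s = 1 := by
  have h₁ : (Matrix.of fun (_ : Unit) j => s j) * (Matrix.of fun i (_ : Unit) => s i) = 1 := by
    ext i j
    simp [Matrix.mul_apply, hs]
  have h₂ : (Matrix.of fun i j => s i * s j) =
      (Matrix.of fun i (_ : Unit) => s i) * (Matrix.of fun (_ : Unit) j => s j) := by
    ext i j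
    simp [Matrix.mul_apply]
  rw [dilationUnitary, Matrix.fromBlocks_multiply, h₂, ← Matrix.fromBlocks_one]
  -- With `U` the row and `V` the column, all four block identities follow from `U * V = 1`, which
  -- makes `V * U` idempotent.
  generalize (Matrix.of fun (_ : Unit) j => s j) = U at *
  generalize (Matrix.of fun i (_ : Unit) => s i) = V at *
  congr 1
  · simp [h₁]
  · simp [Matrix.mul_sub, ← Matrix.mul_assoc, h₁]
  · simp [Matrix.sub_mul, Matrix.mul_assoc, h₁]
  · have : V * U * (V * U) = V * U := by
      rw [Matrix.mul_assoc, ← Matrix.mul_assoc U, h₁, Matrix.one_mul]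
    simp [mul_sub, sub_mul, this]

theorem commute_dilationUnitary {s : Fin n → R} {T : R} (h : ∀ i, Commute T (s i))
    (i j : Unit ⊕ Fin n) : Commute T (dilationUnitary s i j) := by
  rcases i with i | i <;> rcases j with j | j
  · simp [dilationUnitary]
  · simpa [dilationUnitary] using h j
  · simpa [dilationUnitary] using h i
  · simp only [dilationUnitary, Matrix.fromBlocks_apply₂₂, Matrix.sub_apply, Matrix.of_apply]
    refine Commute.sub_right ?_ ((h i).mul_right (h j))
    rw [Matrix.one_apply]
    split_ifs
    exacts [Commute.one_right T, Commute.zero_right T]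

end Dilation

/-- A measurement given by positive operators. -/
structure IsPositiveMeasurement {A H : Type*} [Fintype A] [NormedAddCommGroup H]
    [InnerProductSpace ℂ H] [CompleteSpace H] (α : A → H →L[ℂ] H) : Prop where
  nonneg : ∀ a, 0 ≤ α a
  sum_eq_one : ∑ a, α a = 1

theorem IsProjectiveMeasurement.map {A H K : Type*} [Fintype A] [NormedAddCommGroup H]
    [InnerProductSpace ℂ H] [CompleteSpace H] [NormedAddCommGroup K]
    [InnerProductSpace ℂ K] [CompleteSpace K] {E : A → H →L[ℂ] H} (hE : IsProjectiveMeasurement E)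
    (π : (H →L[ℂ] H) →⋆ₐ[ℂ] (K →L[ℂ] K)) : IsProjectiveMeasurement fun a => π (E a) where
  selfAdjoint a := (hE.selfAdjoint a).map π
  idem a := by rw [← map_mul, hE.idem]
  orthogonal a a' h := by rw [← map_mul, hE.orthogonal a a' h, map_zero]
  sum_eq_one := by rw [← map_sum, hE.sum_eq_one, map_one]

theorem IsPositiveMeasurement.map {A H K : Type*} [Fintype A] [NormedAddCommGroup H]
    [InnerProductSpace ℂ H] [CompleteSpace H] [NormedAddCommGroup K]
    [InnerProductSpace ℂ K] [CompleteSpace K] {α : A → H →L[ℂ] H} (hα : IsPositiveMeasurement α)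
    (π : (H →L[ℂ] H) →⋆ₐ[ℂ] (K →L[ℂ] K)) : IsPositiveMeasurement fun a => π (α a) where
  nonneg a := map_nonneg π (hα.nonneg a)
  sum_eq_one := by rw [← map_sum, hα.sum_eq_one, map_one]

/-- Naimark dilation of a family of measurements, compatible with the operators that commute with
the measurements. -/
theorem exists_dilation {X A : Type*} [Fintype A] {H : Type} [NormedAddCommGroup H]
    [InnerProductSpace ℂ H] [CompleteSpace H] [Nonempty A] {α : X → A → H →L[ℂ] H}
    (hα : ∀ x, IsPositiveMeasurement (α x)) :
    ∃ (K : Type) (_ : NormedAddCommGroup K) (_ : InnerProductSpace ℂ K) (_ : CompleteSpace K)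
      (J : H →ₗᵢ[ℂ] K) (π : (H →L[ℂ] H) →⋆ₐ[ℂ] (K →L[ℂ] K)) (E : X → A → K →L[ℂ] K),
      (∀ x, IsProjectiveMeasurement (E x)) ∧ (∀ T v, π T (J v) = J (T v)) ∧
      (∀ x a v w, inner ℂ (J v) (E x a (J w)) = inner ℂ v (α x a w)) ∧
      ∀ T x, (∀ a, Commute T (α x a)) → ∀ a, Commute (π T) (E x a) := by
  classical
  let n := Fintype.card A
  let e : A ≃ Fin n := Fintype.equivFin A
  let a₀ : A := Classical.arbitrary A
  -- The square roots are the components of Naimark's isometry. Its unitary extension depends on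
  -- `x`, but the inclusion of `H` does not, so all measurements are dilated in one space.
  let s : X → Fin n → H →L[ℂ] H := fun x i => CFC.sqrt (α x (e.symm i))
  have hs : ∀ x i, star (s x i) = s x i := fun x i =>
    (IsSelfAdjoint.of_nonneg (CFC.sqrt_nonneg _)).star_eq
  have hss : ∀ x i, s x i * s x i = α x (e.symm i) := fun x i =>
    CFC.sqrt_mul_sqrt_self _ ((hα x).nonneg _)
  have hsum : ∀ x, ∑ i, s x i * s x i = 1 := fun x => by
    simp_rw [hss]
    rw [e.symm.sum_comp, (hα x).sum_eq_one]
  -- The additional summand is given to `a₀` so that the projections sum to `1`. The compression to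
  -- `H` does not see this, since the corner of `dilationUnitary` vanishes.
  let d : A → Unit ⊕ Fin n → H →L[ℂ] H := fun a =>
    Sum.elim (fun _ => if a = a₀ then 1 else 0) fun i => if a = e.symm i then 1 else 0
  let D : A → Matrix (Unit ⊕ Fin n) (Unit ⊕ Fin n) (H →L[ℂ] H) := fun a => Matrix.diagonal (d a)
  let W := fun x => dilationUnitary (s x)
  have hW : ∀ x, W x * W x = 1 := fun x => dilationUnitary_mul_self (hsum x)
  have hWs : ∀ x, star (W x) = W x := fun x => star_dilationUnitary (hs x)
  have hWD : ∀ x a a', W x * D a * W x * (W x * D a' * W x) = W x * (D a * D a') * W x :=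
    fun x a a' => by
      rw [show W x * D a * W x * (W x * D a' * W x) = W x * D a * (W x * W x) * D a' * W x by
        simp only [mul_assoc], hW, mul_one]
      simp only [mul_assoc]
  refine ⟨HilbertPower (Unit ⊕ Fin n) H, inferInstance, inferInstance, inferInstance,
    blockInclusion (Sum.inl ()), amplify _ H, fun x a => blockOp _ H (W x * D a * W x), fun x => ?_,
    fun T v => amplify_blockInclusion T _ v, fun x a v w => ?_, fun T x hT a => ?_⟩
  · refine ⟨fun a => ?_, fun a => ?_, fun a a' h => ?_, ?_⟩
    · refine IsSelfAdjoint.map ?_ (blockOp _ H)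
      have : star (D a) = D a := by
        simp only [D, Matrix.star_eq_conjTranspose, Matrix.diagonal_conjTranspose]
        congr 1
        funext i
        rcases i with i | i <;> simp only [d, Pi.star_apply, Sum.elim_inl, Sum.elim_inr] <;>
          split_ifs <;> simp
      simp [IsSelfAdjoint, hWs, this, mul_assoc]
    · rw [← map_mul, hWD]
      congr 3
      simp only [D, Matrix.diagonal_mul_diagonal]
      congr 1
      funext i
      rcases i with i | i <;> simp only [d, Sum.elim_inl, Sum.elim_inr] <;> split_ifs <;> simp
    · rw [← map_mul, hWD]
      have : D a * D a' = 0 := by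
        simp only [D, Matrix.diagonal_mul_diagonal]
        rw [Matrix.diagonal_eq_zero]
        funext i
        rcases i with i | i
        · simp only [d, Sum.elim_inl, Pi.zero_apply]
          split_ifs with h₁ h₂
          exacts [absurd (h₁.trans h₂.symm) h, by simp, by simp, by simp]
        · simp only [d, Sum.elim_inr, Pi.zero_apply]
          split_ifs with h₁ h₂
          exacts [absurd (h₁.trans h₂.symm) h, by simp, by simp, by simp]
      simp [this]
    · rw [← map_sum, ← Finset.sum_mul, ← Finset.mul_sum]
      have : ∑ a, D a = 1 := by
        ext i j : 1
        rw [Matrix.sum_apply, Matrix.one_apply]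
        by_cases hij : i = j
        · subst hij
          rcases i with i | i <;> simp [D, d]
        · simp [D, hij]
      rw [this, mul_one, hW, map_one]
  · rw [inner_blockInclusion_blockOp]
    congr 2
    rw [Matrix.mul_apply]
    simp [D, W, d, Matrix.mul_diagonal, dilationUnitary, hss, Equiv.eq_symm_apply]
  · refine commute_amplify_blockOp fun i j => ?_
    -- Whatever commutes with a positive operator commutes with its square root.
    have hTs : ∀ i, Commute T (s x i) := fun i =>
      (Commute.cfcₙ_nnreal (hT (e.symm i)).symm _).symm
    rw [Matrix.mul_apply]
    refine Commute.sum_right _ _ _ fun k _ => ?_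
    rw [Matrix.mul_diagonal]
    refine ((commute_dilationUnitary hTs i k).mul_right ?_).mul_right
      (commute_dilationUnitary hTs k j)
    rcases k with k | k <;> simp only [d, Sum.elim_inl, Sum.elim_inr] <;> split_ifs <;> simp

section QuantumSet

variable {X Y A B : Type*} [Fintype A] [Fintype B]

/-- Commuting measurements by positive operators generate quantum distributions. -/
theorem mem_quantumSet_of_isPositiveMeasurement [Nonempty A] [Nonempty B] {H : Type}
    [NormedAddCommGroup H] [InnerProductSpace ℂ H] [CompleteSpace H] {ψ : H} (hψ : ‖ψ‖ = 1)
    {α : X → A → H →L[ℂ] H} {β : Y → B → H →L[ℂ] H} (hα : ∀ x, IsPositiveMeasurement (α x))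
    (hβ : ∀ y, IsPositiveMeasurement (β y)) (hc : ∀ x y a b, Commute (α x a) (β y b))
    {p : Behavior X Y A B} (hp : ∀ x y a b, (p x y a b : ℂ) = inner ℂ ψ (α x a (β y b ψ))) :
    p ∈ quantumSet X Y A B := by
  -- Alice's measurements are dilated first, then Bob's amplified ones. Each time the other player's
  -- operators are carried along by amplification, which preserves commutation.
  obtain ⟨K, _, _, _, J, π, E, hE, hπJ, hEJ, hcE⟩ := exists_dilation hα
  obtain ⟨L, _, _, _, J', π', F, hF, hπJ', hFJ', hcF⟩ :=
    exists_dilation (fun y => (hβ y).map π)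
  refine ⟨L, inferInstance, inferInstance, inferInstance, J' (J ψ), fun x a => π' (E x a), F,
    by simp [hψ], fun x => (hE x).map π', hF, fun x y a b => ?_, fun x y a b => ?_⟩
  · exact hcF _ y (fun b => (hcE _ x (fun a => (hc x y a b).symm) a).symm) b
  · have hsa := ((hE x).map π').selfAdjoint a
    rw [ContinuousLinearMap.isSelfAdjoint_iff'] at hsa
    rw [← ContinuousLinearMap.adjoint_inner_left, hsa, hπJ', hFJ', hπJ]
    have hsa' := (hE x).selfAdjoint a
    rw [ContinuousLinearMap.isSelfAdjoint_iff'] at hsa'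
    rw [← ContinuousLinearMap.adjoint_inner_right, hsa', hEJ, hp]

open ComplexOrder in
theorem IsStochastic.isPositiveMeasurement {α : X → A → ℝ} (hα : IsStochastic α) (x : X) :
    IsPositiveMeasurement fun a => (α x a : ℂ) • (1 : ℂ →L[ℂ] ℂ) where
  nonneg a := smul_nonneg (by exact_mod_cast hα.nonneg x a) zero_le_one
  sum_eq_one := by
    rw [← Finset.sum_smul, ← Complex.ofReal_sum, hα.sum_eq_one]
    simp

/-- On the space `ℂ` probabilities themselves are positive measurements, and they commute. -/
theorem containsProducts_quantumSet [Nonempty X] [Nonempty Y] :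
    ContainsProducts (quantumSet X Y A B) := by
  intro α β hα hβ
  obtain ⟨x⟩ := ‹Nonempty X›
  obtain ⟨y⟩ := ‹Nonempty Y›
  have hA : Nonempty A := by
    by_contra h
    have := hα.sum_eq_one x
    simp [not_nonempty_iff.1 h] at this
  have hB : Nonempty B := by
    by_contra h
    have := hβ.sum_eq_one y
    simp [not_nonempty_iff.1 h] at this
  refine mem_quantumSet_of_isPositiveMeasurement (ψ := (1 : ℂ)) (by simp) hα.isPositiveMeasurement
    hβ.isPositiveMeasurement (fun x y a b => ?_) fun x y a b => ?_
  · simp [Commute, SemiconjBy, smul_smul, mul_comm]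
  · simp [productBehavior]

end QuantumSet

/-! ### Maximally entangled pairs -/

section QubitPairs

variable {R : Type*} [Ring R] [Algebra ℂ R] [StarRing R]

/-- The projection onto the maximally entangled state of two qubits. -/
def eprProj (ρ σ : Matrix (Fin 2) (Fin 2) ℂ →⋆ₐ[ℂ] R) : R :=
  (1 / 2 : ℂ) • ∑ a, ∑ b, ρ (Matrix.single a b 1) * σ (Matrix.single a b 1)

/-- The operator exchanging two qubits. -/
def swapOp (ρ σ : Matrix (Fin 2) (Fin 2) ℂ →⋆ₐ[ℂ] R) : R :=
  ∑ a, ∑ b, ρ (Matrix.single a b 1) * σ (Matrix.single b a 1)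

variable {ρ σ τ : Matrix (Fin 2) (Fin 2) ℂ →⋆ₐ[ℂ] R}

theorem commute_eprProj {T : R} (hρ : ∀ M, Commute T (ρ M)) (hσ : ∀ M, Commute T (σ M)) :
    Commute T (eprProj ρ σ) :=
  (Commute.sum_right _ _ _ fun _ _ => Commute.sum_right _ _ _ fun _ _ =>
    (hρ _).mul_right (hσ _)).smul_right _

theorem commute_swapOp {T : R} (hρ : ∀ M, Commute T (ρ M)) (hσ : ∀ M, Commute T (σ M)) :
    Commute T (swapOp ρ σ) :=
  Commute.sum_right _ _ _ fun _ _ => Commute.sum_right _ _ _ fun _ _ => (hρ _).mul_right (hσ _)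

theorem map_single_mul_map_single (a b c d : Fin 2) :
    ρ (Matrix.single a b 1) * ρ (Matrix.single c d 1) =
      if b = c then ρ (Matrix.single a d 1) else 0 := by
  rw [← map_mul]
  split_ifs with h
  · subst h
    simp
  · rw [Matrix.single_mul_single_of_ne _ _ _ _ h, map_zero]

theorem star_map_single (a b : Fin 2) :
    star (ρ (Matrix.single a b 1)) = ρ (Matrix.single b a 1) := by
  rw [← map_star, Matrix.star_eq_conjTranspose, Matrix.conjTranspose_single, star_one]

theorem sum_map_single : ∑ a, ρ (Matrix.single a a 1) = 1 := by
  rw [← map_sum, ← map_one ρ]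
  congr 1
  ext i j
  fin_cases i <;> fin_cases j <;> simp [Matrix.single]

theorem star_eprProj [StarModule ℂ R] (h : ∀ M N, Commute (ρ M) (σ N)) :
    star (eprProj ρ σ) = eprProj ρ σ := by
  simp only [eprProj, star_smul, star_sum, star_mul, star_map_single]
  rw [Finset.sum_comm]
  simp [fun a b => (h (Matrix.single a b 1) (Matrix.single a b 1)).eq]

theorem eprProj_mul_self (h : ∀ M N, Commute (ρ M) (σ N)) :
    eprProj ρ σ * eprProj ρ σ = eprProj ρ σ := by
  have : ∀ a b c d, ρ (Matrix.single a b 1) * σ (Matrix.single a b 1) *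
      (ρ (Matrix.single c d 1) * σ (Matrix.single c d 1)) =
      if b = c then ρ (Matrix.single a d 1) * σ (Matrix.single a d 1) else 0 :=
    fun a b c d => by
      rw [(h _ _).symm.mul_mul_mul_comm, map_single_mul_map_single, map_single_mul_map_single]
      split_ifs <;> simp
  -- The contracted index takes two values, whence the factor `2` that the normalization `1 / 2`
  -- absorbs.
  have h₂ : (∑ a, ∑ b, ρ (Matrix.single a b 1) * σ (Matrix.single a b 1)) *
      (∑ a, ∑ b, ρ (Matrix.single a b 1) * σ (Matrix.single a b 1)) =
      (2 : ℂ) • ∑ a, ∑ b, ρ (Matrix.single a b 1) * σ (Matrix.single a b 1) := by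
    simp only [Finset.sum_mul_sum, this]
    simp only [Fin.sum_univ_two, Fin.isValue, if_true, zero_ne_one, one_ne_zero, if_false]
    module
  rw [eprProj, smul_mul_smul_comm, h₂, smul_smul]
  norm_num

theorem star_swapOp (h : ∀ M N, Commute (ρ M) (σ N)) : star (swapOp ρ σ) = swapOp ρ σ := by
  simp only [swapOp, star_sum, star_mul, star_map_single]
  rw [Finset.sum_comm]
  simp [fun a b => (h (Matrix.single a b 1) (Matrix.single b a 1)).eq]

theorem swapOp_mul_self (h : ∀ M N, Commute (ρ M) (σ N)) : swapOp ρ σ * swapOp ρ σ = 1 := by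
  have : ∀ a b c d, ρ (Matrix.single a b 1) * σ (Matrix.single b a 1) *
      (ρ (Matrix.single c d 1) * σ (Matrix.single d c 1)) =
      if b = c then if a = d then ρ (Matrix.single a a 1) * σ (Matrix.single b b 1) else 0 else 0 :=
    fun a b c d => by
      rw [(h _ _).symm.mul_mul_mul_comm, map_single_mul_map_single, map_single_mul_map_single]
      split_ifs <;> simp_all
  simp only [swapOp, Finset.sum_mul_sum, this]
  rw [← mul_one (1 : R)]
  nth_rw 1 [← sum_map_single (ρ := ρ)]
  rw [← sum_map_single (ρ := σ), Finset.sum_mul_sum]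
  simp [Fin.sum_univ_two]

theorem swapOp_mul_map (h : ∀ M N, Commute (ρ M) (σ N)) (M : Matrix (Fin 2) (Fin 2) ℂ) :
    swapOp ρ σ * ρ M = σ M * swapOp ρ σ := by
  have key : ∀ c d, swapOp ρ σ * ρ (Matrix.single c d 1) =
      σ (Matrix.single c d 1) * swapOp ρ σ := fun c d => by
    simp only [swapOp, Finset.sum_mul, Finset.mul_sum]
    have h₁ : ∀ a b, ρ (Matrix.single a b 1) * σ (Matrix.single b a 1) *
        ρ (Matrix.single c d 1) =
        if b = c then ρ (Matrix.single a d 1) * σ (Matrix.single c a 1) else 0 := fun a b => by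
      rw [mul_assoc, ← (h _ _).eq, ← mul_assoc, map_single_mul_map_single]
      split_ifs <;> simp_all
    have h₂ : ∀ a b, σ (Matrix.single c d 1) *
        (ρ (Matrix.single a b 1) * σ (Matrix.single b a 1)) =
        if d = b then ρ (Matrix.single a d 1) * σ (Matrix.single c a 1) else 0 := fun a b => by
      rw [← mul_assoc, ← (h _ _).eq, mul_assoc, map_single_mul_map_single]
      split_ifs <;> simp_all
    simp [h₁, h₂]
  have hM : M = ∑ c, ∑ d, M c d • Matrix.single c d 1 := by
    rw [Matrix.matrix_eq_sum_single M]
    simp [Matrix.smul_single]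
  rw [hM]
  simp only [map_sum, map_smul, Finset.mul_sum, Finset.sum_mul, mul_smul_comm, smul_mul_assoc, key]

/-- Postselected teleportation: projecting a qubit and one half of an entangled pair onto the
entangled state moves the qubit to the other half, with amplitude `1 / 2`. -/
theorem eprProj_mul_eprProj (hστ : ∀ M N, Commute (σ M) (τ N)) :
    eprProj ρ σ * eprProj σ τ = (1 / 2 : ℂ) • (swapOp ρ τ * eprProj σ τ) := by
  -- Both products contract to the same triple sum over `a`, `b`, `d`; the left side has prefactor
  -- `1 / 2` squared, and so has the right.
  have h₁ : ∀ a b c d, ρ (Matrix.single a b 1) * σ (Matrix.single a b 1) *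
      (σ (Matrix.single c d 1) * τ (Matrix.single c d 1)) =
      if b = c then ρ (Matrix.single a b 1) * σ (Matrix.single a d 1) * τ (Matrix.single b d 1)
      else 0 := fun a b c d => by
    rw [mul_assoc, ← mul_assoc (σ _), map_single_mul_map_single]
    split_ifs <;> simp_all [mul_assoc]
  have h₂ : ∀ a b c d, ρ (Matrix.single a b 1) * τ (Matrix.single b a 1) *
      (σ (Matrix.single c d 1) * τ (Matrix.single c d 1)) =
      if a = c then ρ (Matrix.single a b 1) * σ (Matrix.single a d 1) * τ (Matrix.single b d 1)
      else 0 := fun a b c d => by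
    rw [(hστ _ _).eq, mul_assoc, ← mul_assoc (τ _), map_single_mul_map_single]
    split_ifs with h
    · subst h
      rw [← (hστ _ _).eq, mul_assoc]
    · simp
  rw [eprProj, eprProj, swapOp, smul_mul_smul_comm, mul_smul_comm, smul_smul]
  congr 1
  simp only [Finset.sum_mul_sum, h₁, h₂]
  simp only [Fin.sum_univ_two, Fin.isValue, if_true, zero_ne_one, one_ne_zero, if_false]
  abel

end QubitPairs

/-! ### Adjoining maximally entangled pairs to a Hilbert space. -/

section Extension

open scoped Kronecker

variable {ι H : Type} [Fintype ι] [DecidableEq ι] [NormedAddCommGroup H] [InnerProductSpace ℂ H]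
  [CompleteSpace H]

variable (ι H) in
/-- Matrices of numbers act on a direct sum of copies of `H`. -/
def scalarOp : Matrix ι ι ℂ →⋆ₐ[ℂ] (HilbertPower ι H →L[ℂ] HilbertPower ι H) :=
  (blockOp ι H).comp
    { (Algebra.ofId ℂ (H →L[ℂ] H)).mapMatrix with
      map_star' := fun M => by
        ext i j : 1
        simp [Matrix.star_apply, Algebra.ofId_apply, Algebra.algebraMap_eq_smul_one] }

theorem scalarOp_eq (M : Matrix ι ι ℂ) :
    scalarOp ι H M = blockOp ι H (M.map (algebraMap ℂ (H →L[ℂ] H))) := rfl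

theorem scalarOp_apply (M : Matrix ι ι ℂ) (v : HilbertPower ι H) (i : ι) :
    scalarOp ι H M v i = ∑ j, M i j • v j := by
  rw [scalarOp_eq, blockOp_apply]
  simp [Algebra.algebraMap_eq_smul_one]

theorem commute_scalarOp_amplify (M : Matrix ι ι ℂ) (T : H →L[ℂ] H) :
    Commute (scalarOp ι H M) (amplify ι H T) :=
  (commute_amplify_blockOp fun i j => (Algebra.commutes (M i j) T).symm).symm

theorem scalarOp_tensorIsometry {M : Matrix ι ι ℂ} {c : ι → ℂ} {hc : ∑ i, ‖c i‖ ^ 2 = 1}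
    (h : M.mulVec c = c) (v : H) :
    scalarOp ι H M (tensorIsometry c hc v) = tensorIsometry c hc v := by
  ext i
  rw [scalarOp_apply]
  have := congrArg (· • v) (congrFun h i)
  simpa [Matrix.mulVec, dotProduct, Finset.sum_smul, smul_smul] using this

theorem amplify_tensorIsometry {c : ι → ℂ} {hc : ∑ i, ‖c i‖ ^ 2 = 1} (T : H →L[ℂ] H) (v : H) :
    amplify ι H T (tensorIsometry c hc v) = tensorIsometry c hc (T v) := by
  ext i
  rw [amplify_apply, tensorIsometry_apply, tensorIsometry_apply, map_smul]

variable (ι) in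
/-- The action of matrices on the first tensor factor. -/
def leftFactor : Matrix ι ι ℂ →⋆ₐ[ℂ] Matrix (ι × ι) (ι × ι) ℂ where
  toFun M := M ⊗ₖ 1
  map_one' := Matrix.one_kronecker_one
  map_mul' M N := by rw [← Matrix.mul_kronecker_mul, one_mul]
  map_zero' := Matrix.zero_kronecker _
  map_add' M N := Matrix.add_kronecker _ _ _
  commutes' c := by
    rw [Algebra.algebraMap_eq_smul_one, Algebra.algebraMap_eq_smul_one, Matrix.smul_kronecker,
      Matrix.one_kronecker_one]
  map_star' M := by simp [Matrix.star_eq_conjTranspose, Matrix.conjTranspose_kronecker]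

variable (ι) in
/-- The action of matrices on the second tensor factor. -/
def rightFactor : Matrix ι ι ℂ →⋆ₐ[ℂ] Matrix (ι × ι) (ι × ι) ℂ where
  toFun M := 1 ⊗ₖ M
  map_one' := Matrix.one_kronecker_one
  map_mul' M N := by rw [← Matrix.mul_kronecker_mul, one_mul]
  map_zero' := Matrix.kronecker_zero _
  map_add' M N := Matrix.kronecker_add _ _ _
  commutes' c := by
    rw [Algebra.algebraMap_eq_smul_one, Algebra.algebraMap_eq_smul_one, Matrix.kronecker_smul,
      Matrix.one_kronecker_one]
  map_star' M := by simp [Matrix.star_eq_conjTranspose, Matrix.conjTranspose_kronecker]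

theorem leftFactor_mul_rightFactor (M N : Matrix ι ι ℂ) :
    leftFactor ι M * rightFactor ι N = M ⊗ₖ N := by
  change (M ⊗ₖ 1) * (1 ⊗ₖ N) = _
  rw [← Matrix.mul_kronecker_mul, one_mul, mul_one]

theorem commute_leftFactor_rightFactor (M N : Matrix ι ι ℂ) :
    Commute (leftFactor ι M) (rightFactor ι N) := by
  rw [Commute, SemiconjBy, leftFactor_mul_rightFactor]
  change _ = (1 ⊗ₖ N) * (M ⊗ₖ 1)
  rw [← Matrix.mul_kronecker_mul, one_mul, mul_one]

end Extension

/-- The space `K` arises from `H` by adding `q` maximally entangled pairs of qubits, on which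
`σ j` and `τ j` act. -/
structure EntangledExtension (q : ℕ) (H K : Type) [NormedAddCommGroup H] [InnerProductSpace ℂ H]
    [CompleteSpace H] [NormedAddCommGroup K] [InnerProductSpace ℂ K] [CompleteSpace K] where
  incl : H →ₗᵢ[ℂ] K
  amp : (H →L[ℂ] H) →⋆ₐ[ℂ] (K →L[ℂ] K)
  σ : Fin q → Matrix (Fin 2) (Fin 2) ℂ →⋆ₐ[ℂ] (K →L[ℂ] K)
  τ : Fin q → Matrix (Fin 2) (Fin 2) ℂ →⋆ₐ[ℂ] (K →L[ℂ] K)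
  amp_incl : ∀ T v, amp T (incl v) = incl (T v)
  commute_σ_amp : ∀ j M T, Commute (σ j M) (amp T)
  commute_τ_amp : ∀ j M T, Commute (τ j M) (amp T)
  commute_σ_τ : ∀ i j M N, Commute (σ i M) (τ j N)
  commute_σ_σ : ∀ i j, i ≠ j → ∀ M N, Commute (σ i M) (σ j N)
  commute_τ_τ : ∀ i j, i ≠ j → ∀ M N, Commute (τ i M) (τ j N)
  eprProj_incl : ∀ j v, eprProj (σ j) (τ j) (incl v) = incl v

section ExistsExtension

variable (H : Type) [NormedAddCommGroup H] [InnerProductSpace ℂ H] [CompleteSpace H]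

/-- The space is `H ⊗ ℂ² ⊗ ℂ²`, and `H` is embedded by tensoring with the unit vector `(e₀₀ + e₁₁) /
√2`. -/
theorem exists_entangledExtension_one :
    ∃ (K : Type) (_ : NormedAddCommGroup K) (_ : InnerProductSpace ℂ K) (_ : CompleteSpace K),
      Nonempty (EntangledExtension 1 H K) := by
  let c : Fin 2 × Fin 2 → ℂ := fun i => if i.1 = i.2 then ((Real.sqrt 2)⁻¹ : ℝ) else 0
  have hc : ∑ i, ‖c i‖ ^ 2 = 1 := by
    simp [c, Fintype.sum_prod_type, Fin.sum_univ_two]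
    norm_num
  refine ⟨HilbertPower (Fin 2 × Fin 2) H, inferInstance, inferInstance, inferInstance, ⟨
    { incl := tensorIsometry c hc
      amp := amplify _ H
      σ := fun _ => (scalarOp _ H).comp (leftFactor (Fin 2))
      τ := fun _ => (scalarOp _ H).comp (rightFactor (Fin 2))
      amp_incl := amplify_tensorIsometry
      commute_σ_amp := fun _ M T => commute_scalarOp_amplify _ T
      commute_τ_amp := fun _ M T => commute_scalarOp_amplify _ T
      commute_σ_τ := fun _ _ M N => (commute_leftFactor_rightFactor M N).map (scalarOp _ H)
      commute_σ_σ := fun i j h => absurd (Subsingleton.elim i j) h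
      commute_τ_τ := fun i j h => absurd (Subsingleton.elim i j) h
      eprProj_incl := fun _ v => ?_ }⟩⟩
  -- Pulled out of the representation, the claim is that a `4 × 4` matrix fixes the vector `c`.
  have : eprProj ((scalarOp _ H).comp (leftFactor (Fin 2)))
      ((scalarOp _ H).comp (rightFactor (Fin 2))) = scalarOp _ H
      (eprProj (leftFactor (Fin 2)) (rightFactor (Fin 2))) := by
    simp [eprProj]
  rw [this]
  refine scalarOp_tensorIsometry ?_ v
  funext i
  simp only [eprProj, leftFactor_mul_rightFactor]
  rcases i with ⟨i, j⟩
  fin_cases i <;> fin_cases j <;>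
    simp [Matrix.mulVec, dotProduct, Fintype.sum_prod_type, Fin.sum_univ_two, Matrix.single, c,
      Matrix.kroneckerMap_apply]
  all_goals ring

/-- Pairs are adjoined one at a time. The newest has index `0`, and the older ones are amplified to
the larger space. -/
theorem exists_entangledExtension (q : ℕ) :
    ∃ (K : Type) (_ : NormedAddCommGroup K) (_ : InnerProductSpace ℂ K) (_ : CompleteSpace K),
      Nonempty (EntangledExtension q H K) := by
  induction q with
  | zero =>
    exact ⟨H, inferInstance, inferInstance, inferInstance, ⟨
      { incl := LinearIsometry.id
        amp := StarAlgHom.id ℂ _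
        σ := fun j => j.elim0
        τ := fun j => j.elim0
        amp_incl := fun _ _ => rfl
        commute_σ_amp := fun j => j.elim0
        commute_τ_amp := fun j => j.elim0
        commute_σ_τ := fun j => j.elim0
        commute_σ_σ := fun j => j.elim0
        commute_τ_τ := fun j => j.elim0
        eprProj_incl := fun j => j.elim0 }⟩⟩
  | succ q ih =>
    obtain ⟨K, _, _, _, ⟨E⟩⟩ := ih
    obtain ⟨L, _, _, _, ⟨F⟩⟩ := exists_entangledExtension_one K
    refine ⟨L, inferInstance, inferInstance, inferInstance, ⟨
      { incl := F.incl.comp E.incl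
        amp := F.amp.comp E.amp
        σ := Fin.cons (F.σ 0) fun j => F.amp.comp (E.σ j)
        τ := Fin.cons (F.τ 0) fun j => F.amp.comp (E.τ j)
        amp_incl := fun T v => by simp [F.amp_incl, E.amp_incl]
        commute_σ_amp := fun j M T => ?_
        commute_τ_amp := fun j M T => ?_
        commute_σ_τ := fun i j M N => ?_
        commute_σ_σ := fun i j h M N => ?_
        commute_τ_τ := fun i j h M N => ?_
        eprProj_incl := fun j v => ?_ }⟩⟩
    · cases j using Fin.cases with
      | zero => exact F.commute_σ_amp 0 M _
      | succ j => exact (E.commute_σ_amp j M T).map F.amp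
    · cases j using Fin.cases with
      | zero => exact F.commute_τ_amp 0 M _
      | succ j => exact (E.commute_τ_amp j M T).map F.amp
    · cases i using Fin.cases with
      | zero =>
        cases j using Fin.cases with
        | zero => exact F.commute_σ_τ 0 0 M N
        | succ j => exact F.commute_σ_amp 0 M _
      | succ i =>
        cases j using Fin.cases with
        | zero => exact (F.commute_τ_amp 0 N _).symm
        | succ j => exact (E.commute_σ_τ i j M N).map F.amp
    · cases i using Fin.cases with
      | zero =>
        cases j using Fin.cases with
        | zero => exact absurd rfl h
        | succ j => exact F.commute_σ_amp 0 M _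
      | succ i =>
        cases j using Fin.cases with
        | zero => exact (F.commute_σ_amp 0 N _).symm
        | succ j => exact (E.commute_σ_σ i j (fun e => h (e ▸ rfl)) M N).map F.amp
    · cases i using Fin.cases with
      | zero =>
        cases j using Fin.cases with
        | zero => exact absurd rfl h
        | succ j => exact F.commute_τ_amp 0 M _
      | succ i =>
        cases j using Fin.cases with
        | zero => exact (F.commute_τ_amp 0 N _).symm
        | succ j => exact (E.commute_τ_τ i j (fun e => h (e ▸ rfl)) M N).map F.amp
    · cases j using Fin.cases with
      | zero => exact F.eprProj_incl 0 _
      | succ j =>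
        have : eprProj (F.amp.comp (E.σ j)) (F.amp.comp (E.τ j)) =
            F.amp (eprProj (E.σ j) (E.τ j)) := by
          simp [eprProj]
        simp only [Fin.cons_succ, LinearIsometry.coe_comp, Function.comp_apply, this, F.amp_incl,
          E.eprProj_incl]

end ExistsExtension

/-! ### Protocols with postselected teleportation -/

/-- Intended for `(k * l)⋆ * (s * t) * (k * l)` with `a = k⋆` and `b = l⋆`: it separates Alice's
conjugated operator from Bob's. -/
theorem Commute.mul_mul_mul_eq {R : Type*} [Semigroup R] {a s k b t l : R} (hab : Commute a b)
    (hsb : Commute s b) (hkb : Commute k b) (hkt : Commute k t) :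
    b * a * (s * t) * (k * l) = a * s * k * (b * t * l) := by
  have h := (hab.mul_left hsb).mul_left hkb
  calc b * a * (s * t) * (k * l) = b * (a * s * (t * k)) * l := by simp only [mul_assoc]
    _ = b * (a * s * k) * t * l := by rw [← hkt.eq]; simp only [mul_assoc]
    _ = a * s * k * (b * t * l) := by rw [← h.eq]; simp only [mul_assoc]

namespace MessageSystem

variable {q : ℕ} {H K : Type} [NormedAddCommGroup H] [InnerProductSpace ℂ H] [CompleteSpace H]
  [NormedAddCommGroup K] [InnerProductSpace ℂ K] [CompleteSpace K]
  (M : MessageSystem q H) (E : EntangledExtension q H K)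

/-- The action of message qubit `j` on the extended space. -/
def message (j : Fin q) : Matrix (Fin 2) (Fin 2) ℂ →⋆ₐ[ℂ] (K →L[ℂ] K) :=
  E.amp.comp (M.qubit j)

theorem commute_message_σ (i j : Fin q) (N N' : Matrix (Fin 2) (Fin 2) ℂ) :
    Commute (M.message E i N) (E.σ j N') :=
  (E.commute_σ_amp j N' _).symm

theorem commute_message_τ (i j : Fin q) (N N' : Matrix (Fin 2) (Fin 2) ℂ) :
    Commute (M.message E i N) (E.τ j N') :=
  (E.commute_τ_amp j N' _).symm

theorem commute_message {i j : Fin q} (h : i ≠ j) (N N' : Matrix (Fin 2) (Fin 2) ℂ) :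
    Commute (M.message E i N) (M.message E j N') :=
  (M.commute_qubit i j h N N').map E.amp

/-- The exchange of message qubit `k` with the receiver's half of the entangled pair. -/
def swapAt (k : ℕ) : K →L[ℂ] K :=
  if h : k < q then swapOp (M.message E ⟨k, h⟩) (E.τ ⟨k, h⟩) else 1

theorem commute_swapAt {T : K →L[ℂ] K} {k : ℕ}
    (h : ∀ j : Fin q, (j : ℕ) = k → ∀ N, Commute T (M.message E j N) ∧ Commute T (E.τ j N)) :
    Commute T (M.swapAt E k) := by
  unfold swapAt
  split_ifs with hk
  · exact commute_swapOp (fun N => (h ⟨k, hk⟩ rfl N).1) fun N => (h ⟨k, hk⟩ rfl N).2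
  · exact Commute.one_right T

theorem swapAt_mem_unitary (k : ℕ) : M.swapAt E k ∈ unitary (K →L[ℂ] K) := by
  unfold swapAt
  split_ifs with hk
  · have h := M.commute_message_τ E ⟨k, hk⟩ ⟨k, hk⟩
    rw [Unitary.mem_iff, star_swapOp h, swapOp_mul_self h]
    simp
  · exact one_mem _

/-- The exchange of the first `k` message qubits with the receivers' halves. -/
def swaps : ℕ → K →L[ℂ] K
  | 0 => 1
  | k + 1 => M.swapAt E k * swaps k

theorem swaps_mem_unitary (k : ℕ) : M.swaps E k ∈ unitary (K →L[ℂ] K) := by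
  induction k with
  | zero => exact one_mem _
  | succ k ih => exact mul_mem (M.swapAt_mem_unitary E k) ih

theorem star_swaps_mul (k : ℕ) : star (M.swaps E k) * M.swaps E k = 1 :=
  (Unitary.mem_iff.1 (M.swaps_mem_unitary E k)).1

theorem swaps_mul_star (k : ℕ) : M.swaps E k * star (M.swaps E k) = 1 :=
  (Unitary.mem_iff.1 (M.swaps_mem_unitary E k)).2

theorem commute_swaps {T : K →L[ℂ] K} {k : ℕ}
    (h : ∀ j : Fin q, (j : ℕ) < k → ∀ N, Commute T (M.message E j N) ∧ Commute T (E.τ j N)) :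
    Commute T (M.swaps E k) := by
  induction k with
  | zero => exact Commute.one_right T
  | succ k ih =>
    exact (M.commute_swapAt E fun j hj => h j (by omega)).mul_right
      (ih fun j hj => h j (by omega))

/-- Only the exchange in round `j` moves message qubit `j`: the earlier ones act on other qubits,
and the later ones commute with the half `τ j` to which it has been moved. -/
theorem swaps_mul_message (k : ℕ) (j : Fin q) (N : Matrix (Fin 2) (Fin 2) ℂ) :
    M.swaps E k * M.message E j N =
      (if (j : ℕ) < k then E.τ j N else M.message E j N) * M.swaps E k := by
  induction k with
  | zero => simp [swaps]
  | succ k ih =>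
    rw [swaps, mul_assoc, ih, ← mul_assoc, ← mul_assoc]
    congr 1
    rcases lt_trichotomy (j : ℕ) k with h | h | h
    · rw [if_pos h, if_pos (h.trans k.lt_succ_self)]
      refine (M.commute_swapAt E fun i hi N' => ⟨E.commute_τ_amp j N _, ?_⟩).symm.eq
      exact E.commute_τ_τ j i (fun e => by subst e; omega) N N'
    · subst h
      rw [if_neg (lt_irrefl _), if_pos (Nat.lt_succ_self _)]
      simp only [swapAt, Fin.is_lt, dif_pos]
      exact swapOp_mul_map (M.commute_message_τ E j j) N
    · rw [if_neg h.le.not_gt, if_neg (by omega)]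
      refine (M.commute_swapAt E fun i hi N' => ⟨?_, M.commute_message_τ E j i N N'⟩).symm.eq
      exact M.commute_message E (fun e => by subst e; omega) N N'

/-- The operators of round `k`, with the first `k` message qubits replaced by the receivers' halves
of the entangled pairs. -/
def relocate (k : ℕ) : (H →L[ℂ] H) →⋆ₐ[ℂ] (K →L[ℂ] K) :=
  ((Unitary.conjStarAlgAut ℂ (K →L[ℂ] K) ⟨M.swaps E k, M.swaps_mem_unitary E k⟩ :
    (K →L[ℂ] K) ≃⋆ₐ[ℂ] (K →L[ℂ] K)) : (K →L[ℂ] K) →⋆ₐ[ℂ] (K →L[ℂ] K)).comp E.amp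

theorem relocate_apply (k : ℕ) (T : H →L[ℂ] H) :
    M.relocate E k T = M.swaps E k * E.amp T * star (M.swaps E k) := rfl

theorem relocate_mul_swaps (k : ℕ) (T : H →L[ℂ] H) :
    M.relocate E k T * M.swaps E k = M.swaps E k * E.amp T := by
  rw [relocate_apply, mul_assoc, star_swaps_mul, mul_one]

theorem relocate_of_commute (k : ℕ) {T : H →L[ℂ] H} (hT : ∀ j N, Commute T (M.qubit j N)) :
    M.relocate E k T = E.amp T := by
  have h : Commute (E.amp T) (M.swaps E k) := M.commute_swaps E fun j _ N =>
    ⟨(hT j N).map E.amp, (E.commute_τ_amp j N T).symm⟩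
  rw [relocate_apply, ← h.eq, mul_assoc, swaps_mul_star, mul_one]

theorem relocate_qubit (k : ℕ) (j : Fin q) (N : Matrix (Fin 2) (Fin 2) ℂ) :
    M.relocate E k (M.qubit j N) = if (j : ℕ) < k then E.τ j N else M.message E j N := by
  rw [relocate_apply]
  change M.swaps E k * M.message E j N * _ = _
  rw [swaps_mul_message, mul_assoc, swaps_mul_star, mul_one]

theorem commute_relocate {S : K →L[ℂ] K} {k : ℕ} (T : H →L[ℂ] H) (hS : ∀ T, Commute S (E.amp T))
    (hτ : ∀ j : Fin q, (j : ℕ) < k → ∀ N, Commute S (E.τ j N)) :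
    Commute S (M.relocate E k T) := by
  have h : Commute S (M.swaps E k) :=
    M.commute_swaps E fun j hj N => ⟨hS _, hτ j hj N⟩
  have h' : Commute S (star (M.swaps E k)) := by
    have e : star (M.swaps E k) * (M.swaps E k * S) = star (M.swaps E k) * (S * M.swaps E k) := by
      rw [h.eq]
    rw [← mul_assoc, star_swaps_mul, one_mul] at e
    rw [Commute, SemiconjBy]
    conv_lhs => rw [e]
    rw [← mul_assoc, mul_assoc _ _ (star _), swaps_mul_star, mul_one]
  rw [relocate_apply]
  exact (h.mul_right (hS T)).mul_right h'

/-- The operators on the parts that a player holds throughout the modified protocol. -/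
def localGenerators (P : Party) : Set (K →L[ℂ] K) :=
  E.amp '' (M.base P) ∪
    ({S | ∃ j, M.sender j = P ∧ ∃ N, S = M.message E j N ∨ S = E.σ j N} ∪
      {S | ∃ j, (M.sender j).other = P ∧ ∃ N, S = E.τ j N})

/-- The algebra generated by the operators on the parts that a player holds throughout. -/
def fixedAlgebra (P : Party) : StarSubalgebra ℂ (K →L[ℂ] K) :=
  StarAlgebra.adjoin ℂ (M.localGenerators E P)

/-- Every tensor factor has one permanent owner: the sender owns the message qubit and the half `σ
j`, the receiver owns `τ j`. Operators of different players thus act on different factors. -/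
theorem commute_localGenerators {S T : K →L[ℂ] K} (hS : S ∈ M.localGenerators E .alice)
    (hT : T ∈ M.localGenerators E .bob) : Commute S T := by
  have hne : ∀ {i j : Fin q}, M.sender i = .alice → M.sender j = .bob → i ≠ j := by
    rintro i j hi hj rfl
    rw [hi] at hj
    cases hj
  have hal : ∀ {P : Party}, P.other = .alice → P = .bob := by
    rintro (_ | _) h <;> first | rfl | cases h
  have hbo : ∀ {P : Party}, P.other = .bob → P = .alice := by
    rintro (_ | _) h <;> first | rfl | cases h
  rcases hS with ⟨S, hS, rfl⟩ | ⟨i, hi, N, rfl | rfl⟩ | ⟨i, hi, N, rfl⟩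
  · rcases hT with ⟨T, hT, rfl⟩ | ⟨j, hj, N', rfl | rfl⟩ | ⟨j, hj, N', rfl⟩
    · exact (M.commute_base S hS T hT).map E.amp
    · exact (M.commute_base_qubit _ S hS j N').map E.amp
    · exact (E.commute_σ_amp j N' S).symm
    · exact (E.commute_τ_amp j N' S).symm
  · rcases hT with ⟨T, hT, rfl⟩ | ⟨j, hj, N', rfl | rfl⟩ | ⟨j, hj, N', rfl⟩
    · exact (M.commute_base_qubit _ T hT i N).symm.map E.amp
    · exact M.commute_message E (hne hi hj) N N'
    · exact M.commute_message_σ E i j N N'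
    · exact M.commute_message_τ E i j N N'
  · rcases hT with ⟨T, hT, rfl⟩ | ⟨j, hj, N', rfl | rfl⟩ | ⟨j, hj, N', rfl⟩
    · exact E.commute_σ_amp i N T
    · exact E.commute_σ_amp i N _
    · exact E.commute_σ_σ i j (hne hi hj) N N'
    · exact E.commute_σ_τ i j N N'
  · rcases hT with ⟨T, hT, rfl⟩ | ⟨j, hj, N', rfl | rfl⟩ | ⟨j, hj, N', rfl⟩
    · exact E.commute_τ_amp i N T
    · exact E.commute_τ_amp i N _
    · exact (E.commute_σ_τ j i N' N).symm
    · exact E.commute_τ_τ i j (hne (hbo hj) (hal hi)).symm N N'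

theorem star_mem_localGenerators {P : Party} {S : K →L[ℂ] K} (hS : S ∈ M.localGenerators E P) :
    star S ∈ M.localGenerators E P := by
  rcases hS with ⟨S, hS, rfl⟩ | ⟨i, hi, N, rfl | rfl⟩ | ⟨i, hi, N, rfl⟩
  · exact Or.inl ⟨star S, star_mem hS, map_star _ _⟩
  · exact Or.inr (Or.inl ⟨i, hi, star N, Or.inl (map_star _ _).symm⟩)
  · exact Or.inr (Or.inl ⟨i, hi, star N, Or.inr (map_star _ _).symm⟩)
  · exact Or.inr (Or.inr ⟨i, hi, star N, (map_star _ _).symm⟩)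

/-- Commutation passes from the generators to the generated algebras by taking centralizers twice.
Closure under `star` is needed because a `*`-centralizer must also commute with adjoints. -/
theorem commute_fixedAlgebra {S T : K →L[ℂ] K} (hS : S ∈ M.fixedAlgebra E .alice)
    (hT : T ∈ M.fixedAlgebra E .bob) : Commute S T := by
  have h₁ : M.fixedAlgebra E .alice ≤ StarSubalgebra.centralizer ℂ (M.localGenerators E .bob) :=
    StarAlgebra.adjoin_le fun S hS => (StarSubalgebra.mem_centralizer_iff ℂ).2 fun T hT =>
      ⟨(M.commute_localGenerators E hS hT).symm,
        (M.commute_localGenerators E hS (M.star_mem_localGenerators E hT)).symm⟩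
  have h₂ : M.fixedAlgebra E .bob ≤
      StarSubalgebra.centralizer ℂ (M.fixedAlgebra E .alice : Set (K →L[ℂ] K)) :=
    StarAlgebra.adjoin_le fun T hT => (StarSubalgebra.mem_centralizer_iff ℂ).2 fun S hS =>
      ⟨(((StarSubalgebra.mem_centralizer_iff ℂ).1 (h₁ hS) T hT).1).symm,
        (((StarSubalgebra.mem_centralizer_iff ℂ).1 (h₁ (star_mem hS)) T hT).1).symm⟩
  exact ((StarSubalgebra.mem_centralizer_iff ℂ).1 (h₂ hT) S hS).1

/-- After `k` rounds the sent qubits sit in halves owned by their receivers and the others are still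
with their senders. So the algebra of round `k`, which varies with `k`, is carried into a fixed one.
-/
theorem relocate_mem {P : Party} {k : ℕ} {T : H →L[ℂ] H} (hT : T ∈ M.localAlgebra P k) :
    M.relocate E k T ∈ M.fixedAlgebra E P := by
  have h : M.localAlgebra P k ≤ (M.fixedAlgebra E P).comap (M.relocate E k) := by
    refine StarAlgebra.adjoin_le ?_
    rintro S (hS | ⟨j, hj, N, rfl⟩)
    · change M.relocate E k S ∈ M.fixedAlgebra E P
      rw [M.relocate_of_commute E k fun j N => M.commute_base_qubit P S hS j N]
      exact StarAlgebra.subset_adjoin ℂ _ (Or.inl ⟨S, hS, rfl⟩)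
    · change M.relocate E k (M.qubit j N) ∈ M.fixedAlgebra E P
      rw [relocate_qubit]
      unfold holder at hj
      split_ifs at hj ⊢
      · exact StarAlgebra.subset_adjoin ℂ _ (Or.inr (Or.inr ⟨j, hj, N, rfl⟩))
      · exact StarAlgebra.subset_adjoin ℂ _ (Or.inr (Or.inl ⟨j, hj, N, Or.inl rfl⟩))
  exact h hT

open Classical in
/-- The projection by which the sender of qubit `k` teleports it. -/
def sendProj (P : Party) (k : ℕ) : K →L[ℂ] K :=
  if h : k < q then
    if M.sender ⟨k, h⟩ = P then eprProj (M.message E ⟨k, h⟩) (E.σ ⟨k, h⟩) else 1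
  else 1

open Classical in
/-- The amplitude that a player loses by sending qubit `k`. -/
def sendAmplitude (P : Party) (k : ℕ) : ℝ :=
  if h : k < q then if M.sender ⟨k, h⟩ = P then 1 / 2 else 1 else 1

theorem sendAmplitude_nonneg (P : Party) (k : ℕ) : 0 ≤ M.sendAmplitude P k := by
  unfold sendAmplitude
  split_ifs <;> norm_num

/-- Each qubit has exactly one sender, so the loss of `1 / 2` is charged to one player. -/
theorem sendAmplitude_mul {k : ℕ} (hk : k < q) :
    M.sendAmplitude .alice k * M.sendAmplitude .bob k = 1 / 2 := by
  unfold sendAmplitude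
  rw [dif_pos hk, dif_pos hk]
  cases M.sender ⟨k, hk⟩ <;> simp

theorem sendProj_mul {k : ℕ} (hk : k < q) :
    M.sendProj E .alice k * M.sendProj E .bob k =
      eprProj (M.message E ⟨k, hk⟩) (E.σ ⟨k, hk⟩) := by
  unfold sendProj
  rw [dif_pos hk, dif_pos hk]
  cases M.sender ⟨k, hk⟩ <;> simp

theorem sendProj_mem (P : Party) (k : ℕ) : M.sendProj E P k ∈ M.fixedAlgebra E P := by
  unfold sendProj
  split_ifs with h₁ h₂
  · refine SMulMemClass.smul_mem _ (sum_mem fun a _ => sum_mem fun b _ => mul_mem ?_ ?_)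
    · exact StarAlgebra.subset_adjoin ℂ _ (Or.inr (Or.inl ⟨_, h₂, _, Or.inl rfl⟩))
    · exact StarAlgebra.subset_adjoin ℂ _ (Or.inr (Or.inl ⟨_, h₂, _, Or.inr rfl⟩))
  · exact one_mem _
  · exact one_mem _

theorem norm_sendProj_le (P : Party) (k : ℕ) : ‖M.sendProj E P k‖ ≤ 1 := by
  unfold sendProj
  split_ifs with h₁ h₂
  · have h := M.commute_message_σ E ⟨k, h₁⟩ ⟨k, h₁⟩
    exact IsStarProjection.norm_le _ ⟨eprProj_mul_self h, star_eprProj h⟩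
  · exact ContinuousLinearMap.norm_id_le
  · exact ContinuousLinearMap.norm_id_le

/-- A vector whose `k`-th entangled pair is intact is teleported. -/
theorem eprProj_apply_of_intact {k : ℕ} (hk : k < q) {v : K}
    (hv : eprProj (E.σ ⟨k, hk⟩) (E.τ ⟨k, hk⟩) v = v) :
    eprProj (M.message E ⟨k, hk⟩) (E.σ ⟨k, hk⟩) v = (1 / 2 : ℂ) • M.swapAt E k v := by
  conv_lhs => rw [← hv]
  rw [← mul_apply_eq_comp, eprProj_mul_eprProj (E.commute_σ_τ _ _)]
  simp only [swapAt, hk, dif_pos, smul_apply, mul_apply_eq_comp, hv]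

/-- A player's part of the modified protocol, up to round `k`. -/
def kraus (P : Party) (U : ℕ → H →L[ℂ] H) : ℕ → K →L[ℂ] K
  | 0 => 1
  | k + 1 => M.sendProj E P k * M.relocate E k (U k) * kraus P U k

variable {U V : ℕ → H →L[ℂ] H}

theorem kraus_mem {P : Party} {k : ℕ} (hU : ∀ j < k, U j ∈ M.localAlgebra P j) :
    M.kraus E P U k ∈ M.fixedAlgebra E P := by
  induction k with
  | zero => exact one_mem _
  | succ k ih =>
    exact mul_mem (mul_mem (M.sendProj_mem E P k) (M.relocate_mem E (hU k k.lt_succ_self)))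
      (ih fun j hj => hU j (hj.trans k.lt_succ_self))

theorem norm_kraus_le {P : Party} {k : ℕ} (hU : ∀ j < k, U j ∈ unitary (H →L[ℂ] H)) :
    ‖M.kraus E P U k‖ ≤ 1 := by
  induction k with
  | zero => exact ContinuousLinearMap.norm_id_le
  | succ k ih =>
    have h : ‖M.relocate E k (U k)‖ ≤ 1 :=
      ContinuousLinearMap.opNorm_le_bound _ zero_le_one fun v => by
        rw [one_mul, ContinuousLinearMap.norm_map_of_mem_unitary
          (Unitary.map_mem (M.relocate E k) (hU k k.lt_succ_self))]
    refine (norm_mul_le _ _).trans (mul_le_one₀ ((norm_mul_le _ _).trans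
      (mul_le_one₀ (M.norm_sendProj_le E P k) (norm_nonneg _) h)) (norm_nonneg _)
      (ih fun j hj => hU j (hj.trans k.lt_succ_self)))

/-- Pair `j` is not touched before it is used in round `j`. This and the next lemmas show that it is
still intact when teleportation needs it. -/
theorem commute_eprProj_relocate (j : Fin q) {k : ℕ} (hk : k ≤ j) (T : H →L[ℂ] H) :
    Commute (eprProj (E.σ j) (E.τ j)) (M.relocate E k T) := by
  refine (commute_eprProj (fun N => ?_) fun N => ?_).symm
  · exact (M.commute_relocate E T (E.commute_σ_amp j N) fun i _ => E.commute_σ_τ j i N).symm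
  · exact (M.commute_relocate E T (E.commute_τ_amp j N) fun i hi =>
      E.commute_τ_τ j i (fun e => by subst e; omega) N).symm

theorem commute_eprProj_swaps (j : Fin q) {k : ℕ} (hk : k ≤ j) :
    Commute (eprProj (E.σ j) (E.τ j)) (M.swaps E k) := by
  refine (commute_eprProj (fun N => ?_) fun N => ?_).symm
  · exact (M.commute_swaps E fun i _ N' => ⟨E.commute_σ_amp j N _, E.commute_σ_τ j i N N'⟩).symm
  · exact (M.commute_swaps E fun i hi N' => ⟨E.commute_τ_amp j N _,
      E.commute_τ_τ j i (fun e => by subst e; omega) N N'⟩).symm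

theorem commute_eprProj_sendProj (P : Party) (j : Fin q) {k : ℕ} (hk : k < j) :
    Commute (eprProj (E.σ j) (E.τ j)) (M.sendProj E P k) := by
  unfold sendProj
  split_ifs with h₁ h₂
  · refine commute_eprProj (fun N => ?_) fun N => ?_
    · exact (commute_eprProj (fun N' => M.commute_message_σ E _ _ _ _)
        fun N' => M.commute_message_τ E _ _ _ _).symm
    · refine (commute_eprProj (fun N' => E.commute_σ_σ _ _ (fun e => ?_) _ _)
        fun N' => E.commute_σ_τ _ _ _ _).symm
      rw [← e] at hk
      exact lt_irrefl _ hk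
  · exact Commute.one_right _
  · exact Commute.one_right _

theorem commute_eprProj_kraus (P : Party) (j : Fin q) {k : ℕ} (hk : k ≤ j) :
    Commute (eprProj (E.σ j) (E.τ j)) (M.kraus E P U k) := by
  induction k with
  | zero => exact Commute.one_right _
  | succ k ih =>
    exact ((M.commute_eprProj_sendProj E P j (by omega)).mul_right
      (M.commute_eprProj_relocate E j (by omega) _)).mul_right (ih (by omega))

/-- Even without the other player's actions, the pair of each qubit that `P` sends is intact in that
round. There the projection acts as `1 / 2` times a unitary; all other factors preserve the norm. -/
theorem norm_kraus_incl_le {P : Party} {k : ℕ} (hU : ∀ j < k, U j ∈ unitary (H →L[ℂ] H)) (v : H) :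
    ‖M.kraus E P U k (E.incl v)‖ ≤ (∏ j ∈ Finset.range k, M.sendAmplitude P j) * ‖v‖ := by
  induction k with
  | zero => simp [kraus]
  | succ k ih =>
    have hu : ‖M.relocate E k (U k) (M.kraus E P U k (E.incl v))‖ =
        ‖M.kraus E P U k (E.incl v)‖ :=
      ContinuousLinearMap.norm_map_of_mem_unitary (Unitary.map_mem (M.relocate E k) (hU k k.lt_succ_self)) _
    have key : ‖M.kraus E P U (k + 1) (E.incl v)‖ =
        M.sendAmplitude P k * ‖M.kraus E P U k (E.incl v)‖ := by
      rw [kraus, mul_assoc, mul_apply_eq_comp, mul_apply_eq_comp]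
      unfold sendProj sendAmplitude
      split_ifs with h₁ h₂
      · rw [M.eprProj_apply_of_intact E h₁, norm_smul,
          ContinuousLinearMap.norm_map_of_mem_unitary (M.swapAt_mem_unitary E k), hu]
        · norm_num
        · have hc := (M.commute_eprProj_relocate E ⟨k, h₁⟩ le_rfl (U k)).mul_right
            (M.commute_eprProj_kraus E (U := U) P ⟨k, h₁⟩ le_rfl)
          have := congrArg (· (E.incl v)) hc.eq
          simpa only [mul_apply_eq_comp, E.eprProj_incl] using this
      · simpa using hu
      · simpa using hu
    rw [key, Finset.prod_range_succ, mul_comm _ (M.sendAmplitude P k), mul_assoc]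
    exact mul_le_mul_of_nonneg_left (ih fun j hj => hU j (hj.trans k.lt_succ_self))
      (M.sendAmplitude_nonneg P k)

end MessageSystem

namespace QuantumProtocol

variable {X Y A B : Type*} [Fintype A] [Fintype B] {q : ℕ} {H K : Type} [NormedAddCommGroup H]
  [InnerProductSpace ℂ H] [CompleteSpace H] [NormedAddCommGroup K] [InnerProductSpace ℂ K]
  [CompleteSpace K] (Q : QuantumProtocol X Y A B q H) (E : EntangledExtension q H K)

/-- Alice's part of the protocol with postselected teleportation. -/
def krausA (x : X) (k : ℕ) : K →L[ℂ] K := Q.kraus E .alice (fun j => Q.unitaryA j x) k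

/-- Bob's part of the protocol with postselected teleportation. -/
def krausB (y : Y) (k : ℕ) : K →L[ℂ] K := Q.kraus E .bob (fun j => Q.unitaryB j y) k

theorem krausA_mem (x : X) {k : ℕ} (hk : k ≤ q) : Q.krausA E x k ∈ Q.fixedAlgebra E .alice :=
  Q.kraus_mem E fun j hj => (Q.unitaryA_mem j (hj.trans_le hk) x).2

theorem krausB_mem (y : Y) {k : ℕ} (hk : k ≤ q) : Q.krausB E y k ∈ Q.fixedAlgebra E .bob :=
  Q.kraus_mem E fun j hj => (Q.unitaryB_mem j (hj.trans_le hk) y).2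

/-- Teleportation reproduces the true state up to relocation of the sent qubits. Relocated unitaries
act on it as the original ones do, and each successful projection contributes one more exchange and
one factor `1 / 2`. -/
theorem krausA_mul_krausB_incl (x : X) (y : Y) {k : ℕ} (hk : k ≤ q) :
    (Q.krausA E x k * Q.krausB E y k) (E.incl Q.init) =
      ((1 / 2 : ℂ) ^ k) • Q.swaps E k (E.incl (Q.state x y k)) := by
  induction k with
  | zero => simp [krausA, krausB, MessageSystem.kraus, MessageSystem.swaps, state]
  | succ k ih =>
    have hk' : k < q := hk
    have hA := Q.relocate_mem E (Q.unitaryA_mem k hk' x).2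
    have hB := Q.relocate_mem E (Q.unitaryB_mem k hk' y).2
    have hKA := Q.krausA_mem E x hk'.le
    have hsB := Q.sendProj_mem E .bob k
    -- Both players' operators are regrouped by round, which is possible because the fixed algebras
    -- commute.
    have h₁ : Q.krausA E x (k + 1) * Q.krausB E y (k + 1) =
        eprProj (Q.message E ⟨k, hk'⟩) (E.σ ⟨k, hk'⟩) *
          (Q.relocate E k (Q.unitaryA k x * Q.unitaryB k y) *
            (Q.krausA E x k * Q.krausB E y k)) := by
      have c₁ := (Q.commute_fixedAlgebra E hA hsB).mul_left (Q.commute_fixedAlgebra E hKA hsB)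
      have c₂ := Q.commute_fixedAlgebra E hKA hB
      rw [← Q.sendProj_mul E hk', map_mul]
      simp only [krausA, krausB, MessageSystem.kraus] at c₁ c₂ ⊢
      calc _ = Q.sendProj E .alice k * ((Q.relocate E k (Q.unitaryA k x) *
              Q.kraus E .alice (fun j => Q.unitaryA j x) k) * Q.sendProj E .bob k) *
              Q.relocate E k (Q.unitaryB k y) * Q.kraus E .bob (fun j => Q.unitaryB j y) k := by
            simp only [mul_assoc]
        _ = Q.sendProj E .alice k * Q.sendProj E .bob k * Q.relocate E k (Q.unitaryA k x) *
              (Q.kraus E .alice (fun j => Q.unitaryA j x) k * Q.relocate E k (Q.unitaryB k y)) *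
              Q.kraus E .bob (fun j => Q.unitaryB j y) k := by
            rw [c₁.eq]
            simp only [mul_assoc]
        _ = _ := by
            rw [c₂.eq]
            simp only [mul_assoc]
    have h₂ : Q.relocate E k (Q.unitaryA k x * Q.unitaryB k y)
        (Q.swaps E k (E.incl (Q.state x y k))) = Q.swaps E k (E.incl (Q.state x y (k + 1))) := by
      rw [← mul_apply_eq_comp, Q.relocate_mul_swaps, mul_apply_eq_comp, E.amp_incl]
      rfl
    rw [h₁, mul_apply_eq_comp, mul_apply_eq_comp, ih hk'.le, map_smul, h₂, map_smul,
      Q.eprProj_apply_of_intact E hk', smul_smul, ← pow_succ]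
    · rfl
    -- The first `k` exchanges leave pair `k` intact.
    · rw [← mul_apply_eq_comp, (Q.commute_eprProj_swaps E ⟨k, hk'⟩ le_rfl).eq, mul_apply_eq_comp,
        E.eprProj_incl]

/-- Regrouping gives the expectation in the vector `kA kB v`, which is `(1 / 2) ^ q` times the
relocated final state; the amplitude enters twice. -/
theorem inner_kraus_conj (x : X) (y : Y) {S T : H →L[ℂ] H} (hS : S ∈ Q.localAlgebra .alice q)
    (hT : T ∈ Q.localAlgebra .bob q) :
    inner ℂ (E.incl Q.init)
      ((star (Q.krausA E x q) * Q.relocate E q S * Q.krausA E x q)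
        ((star (Q.krausB E y q) * Q.relocate E q T * Q.krausB E y q) (E.incl Q.init))) =
      (1 / 4 : ℂ) ^ q * inner ℂ (Q.state x y q) (S (T (Q.state x y q))) := by
  have hA := Q.krausA_mem E x le_rfl
  have hB := Q.krausB_mem E y le_rfl
  have hS' := Q.relocate_mem E hS
  have hT' := Q.relocate_mem E hT
  rw [← mul_apply_eq_comp, ← Commute.mul_mul_mul_eq
    (Q.commute_fixedAlgebra E (star_mem hA) (star_mem hB))
    (Q.commute_fixedAlgebra E hS' (star_mem hB)) (Q.commute_fixedAlgebra E hA (star_mem hB))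
    (Q.commute_fixedAlgebra E hA hT'), ← star_mul, mul_assoc, mul_apply_eq_comp,
    ContinuousLinearMap.star_eq_adjoint, ContinuousLinearMap.adjoint_inner_right,
    mul_apply_eq_comp (Q.relocate E q S * Q.relocate E q T),
    Q.krausA_mul_krausB_incl E x y le_rfl, map_smul, inner_smul_left,
    inner_smul_right, ← map_mul, ← mul_apply_eq_comp, Q.relocate_mul_swaps, mul_apply_eq_comp,
    ContinuousLinearMap.inner_map_map_of_mem_unitary (Q.swaps_mem_unitary E q), E.amp_incl,
    LinearIsometry.inner_map_map, ← mul_assoc]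
  congr 1
  rw [map_pow, ← mul_pow, map_div₀, map_one, map_ofNat]
  norm_num

end QuantumProtocol

/-- An entanglement-assisted protocol is replaced by a strategy without communication in which
each player may abort: Alice accepts with the operator `kA x` and Bob with `kB y`, both with small
probability. -/
theorem SimulableWithQubits.exists_postselected {X Y A B : Type*} [Fintype A] [Fintype B]
    {p : Behavior X Y A B} {q : ℕ} (h : SimulableWithQubits p q) :
    ∃ (K : Type) (_ : NormedAddCommGroup K) (_ : InnerProductSpace ℂ K) (_ : CompleteSpace K)
      (v : K) (kA : X → K →L[ℂ] K) (kB : Y → K →L[ℂ] K) (E : X → A → K →L[ℂ] K)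
      (F : Y → B → K →L[ℂ] K) (rA rB : ℝ),
      ‖v‖ = 1 ∧ (∀ x, ‖kA x‖ ≤ 1) ∧ (∀ y, ‖kB y‖ ≤ 1) ∧
      (∀ x, IsProjectiveMeasurement (E x)) ∧ (∀ y, IsProjectiveMeasurement (F y)) ∧
      0 ≤ rA ∧ 0 ≤ rB ∧ rA * rB = (1 / 2) ^ q ∧
      (∀ x, ‖kA x v‖ ≤ rA) ∧ (∀ y, ‖kB y v‖ ≤ rB) ∧
      (∀ x y a b, Commute (star (kA x) * E x a * kA x) (star (kB y) * F y b * kB y)) ∧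
      ∀ x y a b, inner ℂ v ((star (kA x) * E x a * kA x) ((star (kB y) * F y b * kB y) v)) =
        (1 / 4 : ℂ) ^ q * p x y a b := by
  obtain ⟨H, _, _, _, Q, hp⟩ := h
  obtain ⟨K, _, _, _, ⟨E⟩⟩ := exists_entangledExtension H q
  have hA : ∀ x, ∀ j < q, Q.unitaryA j x ∈ unitary (H →L[ℂ] H) := fun x j hj =>
    (Q.unitaryA_mem j hj x).1
  have hB : ∀ y, ∀ j < q, Q.unitaryB j y ∈ unitary (H →L[ℂ] H) := fun y j hj =>
    (Q.unitaryB_mem j hj y).1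
  refine ⟨K, inferInstance, inferInstance, inferInstance, E.incl Q.init, fun x => Q.krausA E x q,
    fun y => Q.krausB E y q, fun x a => Q.relocate E q (Q.measA x a),
    fun y b => Q.relocate E q (Q.measB y b), ∏ j ∈ Finset.range q, Q.sendAmplitude .alice j,
    ∏ j ∈ Finset.range q, Q.sendAmplitude .bob j, by simp [Q.norm_init],
    fun x => Q.norm_kraus_le E (hA x), fun y => Q.norm_kraus_le E (hB y),
    fun x => (Q.measA_proj x).map _, fun y => (Q.measB_proj y).map _,
    Finset.prod_nonneg fun j _ => Q.sendAmplitude_nonneg _ j,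
    Finset.prod_nonneg fun j _ => Q.sendAmplitude_nonneg _ j, ?_, fun x => ?_, fun y => ?_,
    fun x y a b => ?_, fun x y a b => ?_⟩
  · rw [← Finset.prod_mul_distrib, Finset.prod_congr rfl fun j hj =>
      Q.sendAmplitude_mul (Finset.mem_range.1 hj)]
    simp
  · simpa [Q.norm_init] using! Q.norm_kraus_incl_le E (P := .alice) (hA x) Q.init
  · simpa [Q.norm_init] using! Q.norm_kraus_incl_le E (P := .bob) (hB y) Q.init
  · have h₁ := Q.krausA_mem E x le_rfl
    have h₂ := Q.krausB_mem E y le_rfl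
    exact Q.commute_fixedAlgebra E
      (mul_mem (mul_mem (star_mem h₁) (Q.relocate_mem E (Q.measA_mem x a))) h₁)
      (mul_mem (mul_mem (star_mem h₂) (Q.relocate_mem E (Q.measB_mem y b))) h₂)
  · rw [Q.inner_kraus_conj E x y (Q.measA_mem x a) (Q.measB_mem y b), hp]

/-! ### From postselected strategies to affine quantum models. -/

section Abort

variable {A K : Type*} [Fintype A] [NormedAddCommGroup K] [InnerProductSpace ℂ K] [CompleteSpace K]

/-- The measurement `E` preceded by acceptance with the operator `k`; `none` means rejection. -/
def abortMeasurement (k : K →L[ℂ] K) (E : A → K →L[ℂ] K) : Option A → K →L[ℂ] K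
  | none => 1 - star k * k
  | some a => star k * E a * k

/-- Commutation is known for the accepting elements only; in this form rejection inherits it. -/
theorem abortMeasurement_none {k : K →L[ℂ] K} {E : A → K →L[ℂ] K}
    (hE : IsProjectiveMeasurement E) :
    abortMeasurement k E none = 1 - ∑ a, star k * E a * k := by
  rw [← Finset.sum_mul, ← Finset.mul_sum, hE.sum_eq_one, mul_one]
  rfl

theorem isPositiveMeasurement_abortMeasurement {k : K →L[ℂ] K} (hk : ‖k‖ ≤ 1)
    {E : A → K →L[ℂ] K} (hE : IsProjectiveMeasurement E) :
    IsPositiveMeasurement (abortMeasurement k E) where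
  nonneg o := by
    rcases o with _ | a
    · rw [abortMeasurement, sub_nonneg]
      refine (CStarAlgebra.norm_le_one_iff_of_nonneg (star k * k) (star_mul_self_nonneg k)).1 ?_
      rw [CStarRing.norm_star_mul_self]
      exact mul_le_one₀ hk (norm_nonneg _) hk
    · refine star_left_conjugate_nonneg ?_ k
      rw [← hE.idem a]
      nth_rw 1 [← (hE.selfAdjoint a).star_eq]
      exact star_mul_self_nonneg _
  sum_eq_one := by
    rw [Fintype.sum_option, abortMeasurement_none hE]
    simp [abortMeasurement]

theorem IsPositiveMeasurement.coarsen {A' : Type*} [Fintype A'] [DecidableEq A'] {α : A → K →L[ℂ] K}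
    (hα : IsPositiveMeasurement α) (f : A → A') :
    IsPositiveMeasurement fun a' => ∑ a, if f a = a' then α a else 0 where
  nonneg a' := Finset.sum_nonneg fun a _ => by
    split_ifs
    exacts [hα.nonneg a, le_rfl]
  sum_eq_one := by
    rw [Finset.sum_comm]
    simpa using hα.sum_eq_one

end Abort

/-- Both players accept and output `(a, b)` with probability exactly `4 ^ (-q) * p x y a b`, so the
fallback argument applies with `N = 4 ^ q`. -/
theorem SimulableWithQubits.hasAffineModel {X Y A B : Type*} [Finite X] [Nonempty X] [Nonempty Y]
    [Fintype A] [Fintype B] [DecidableEq A] [DecidableEq B] {p : Behavior X Y A B}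
    (hp : IsNonSignaling p) {q : ℕ} (h : SimulableWithQubits p q) :
    HasAffineModel (quantumSet X Y A B) p (2 ^ (2 * q + 1) - 1) := by
  obtain ⟨K, _, _, _, v, kA, kB, E, F, -, -, hv, hkA, hkB, hE, hF, -, -, -, -, -, hc, hpK⟩ :=
    h.exists_postselected
  obtain ⟨a₀, b₀⟩ := hp.nonempty_outcomes
  have : Nonempty A := ⟨a₀⟩
  have : Nonempty B := ⟨b₀⟩
  let α : X → Option A → K →L[ℂ] K := fun x => abortMeasurement (kA x) (E x)
  let β : Y → Option B → K →L[ℂ] K := fun y => abortMeasurement (kB y) (F y)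
  have hα : ∀ x, IsPositiveMeasurement (α x) := fun x =>
    isPositiveMeasurement_abortMeasurement (hkA x) (hE x)
  have hβ : ∀ y, IsPositiveMeasurement (β y) := fun y =>
    isPositiveMeasurement_abortMeasurement (hkB y) (hF y)
  have hcs : ∀ x y a o', Commute (α x (some a)) (β y o') := fun x y a o' => by
    rcases o' with _ | b
    · simp only [β, abortMeasurement_none (hF y)]
      exact (Commute.one_right _).sub_right (Commute.sum_right _ _ _ fun b _ => hc x y a b)
    · exact hc x y a b
  have hαβ : ∀ x y o o', Commute (α x o) (β y o') := fun x y o o' => by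
    rcases o with _ | a
    · simp only [α, abortMeasurement_none (hE x)]
      exact (Commute.one_left _).sub_left (Commute.sum_left _ _ _ fun a _ => hcs x y a o')
    · exact hcs x y a o'
  let g : X → Y → Option A → Option B → ℝ := fun x y o o' =>
    (inner ℂ v (α x o (β y o' v))).re
  -- A product of commuting positive operators is positive; hence the inner products defining `g`
  -- are real and nonnegative.
  have hpos : ∀ x y o o', 0 ≤ α x o * β y o' := fun x y o o' =>
    (hαβ x y o o').mul_nonneg ((hα x).nonneg o) ((hβ y).nonneg o')
  have hg : ∀ x y o o', 0 ≤ g x y o o' := fun x y o o' =>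
    ((ContinuousLinearMap.nonneg_iff_isPositive _).1 (hpos x y o o')).re_inner_nonneg_right v
  have hgc : ∀ x y o o', (g x y o o' : ℂ) = inner ℂ v (α x o (β y o' v)) := fun x y o o' => by
    have := ((ContinuousLinearMap.nonneg_iff_isPositive _).1 (hpos x y o o')).inner_nonneg_right v
    exact (Complex.eq_re_of_ofReal_le (r := 0) (by simpa using this)).symm
  have hgA : ∀ x y o, ∑ o', g x y o o' = (inner ℂ v (α x o v)).re := fun x y o => by
    simp only [g]
    rw [← Complex.re_sum, ← inner_sum, ← map_sum, ← sum_apply, (hβ y).sum_eq_one]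
    rfl
  have hgB : ∀ x y o', ∑ o, g x y o o' = (inner ℂ v (β y o' v)).re := fun x y o' => by
    simp only [g]
    rw [← Complex.re_sum, ← inner_sum, ← sum_apply, (hα x).sum_eq_one]
    rfl
  have := hasAffineModel_of_relabel containsProducts_quantumSet hp a₀ b₀ (N := 4 ^ q)
    (G := fun x y o o' => 4 ^ q * g x y o o')
    (fun x y o o' => mul_nonneg (by positivity) (hg x y o o'))
    (fun x y => ?_) (fun o x y y' => ?_) (fun o' x x' y => ?_) (fun x y a b => ?_) ?_
  · convert this using 1
    rw [pow_succ', pow_mul]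
    norm_num
  · simp_rw [← Finset.mul_sum, hgA]
    rw [← Complex.re_sum, ← inner_sum, ← sum_apply, (hα x).sum_eq_one]
    simp [hv]
  · simp_rw [← Finset.mul_sum, hgA]
  · simp_rw [← Finset.mul_sum, hgB]
  · apply Complex.ofReal_injective
    push_cast
    rw [hgc]
    simp only [α, β, abortMeasurement, hpK]
    rw [← mul_assoc, ← mul_pow]
    norm_num
  · have hm : relabel a₀ b₀ g ∈ quantumSet X Y A B := by
      refine mem_quantumSet_of_isPositiveMeasurement hv
        (fun x => (hα x).coarsen fun o => o.getD a₀) (fun y => (hβ y).coarsen fun o => o.getD b₀)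
        (fun x y a b => ?_) fun x y a b => ?_
      · refine Commute.sum_left _ _ _ fun o _ => Commute.sum_right _ _ _ fun o' _ => ?_
        split_ifs <;> simp [hαβ]
      · simp only [relabel]
        simp only [Complex.ofReal_sum, sum_apply, map_sum, inner_sum]
        rw [Finset.sum_comm]
        refine Finset.sum_congr rfl fun o' _ => Finset.sum_congr rfl fun o _ => ?_
        by_cases ho : o.getD a₀ = a <;> by_cases ho' : o'.getD b₀ = b <;> simp [ho, ho', hgc]
    convert (HasAffineModel.of_mem hm).smul_of_nonneg (c := 4 ^ q) (by positivity) using 1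
    · funext x y a b
      simp only [relabel, Pi.smul_apply, smul_eq_mul, Finset.mul_sum, mul_ite, mul_zero]
    · simp

/-! ### Realization of inner products by quantum correlations -/

section Clifford

variable {m : ℕ}

/-- The sign `(-1) ^ n`, where `n` is the number of elements of `S` satisfying `r`. -/
def cliffordSign (r : Fin m → Prop) [DecidablePred r] (S : Finset (Fin m)) : ℂ :=
  ∏ k, if r k ∧ k ∈ S then -1 else 1

theorem cliffordSign_symmDiff (r : Fin m → Prop) [DecidablePred r] (S : Finset (Fin m))
    (i : Fin m) :
    cliffordSign r (symmDiff S {i}) = cliffordSign r S * if r i then -1 else 1 := by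
  have h : ∀ k, (if r k ∧ k ∈ symmDiff S {i} then (-1 : ℂ) else 1) =
      (if r k ∧ k ∈ S then -1 else 1) * if k = i then (if r k then -1 else 1) else 1 := fun k => by
    by_cases hk : k = i <;> by_cases hr : r k <;> by_cases hS : k ∈ S <;>
      simp_all [Finset.mem_symmDiff]
  simp only [cliffordSign, h]
  rw [Finset.prod_mul_distrib, Finset.prod_ite_eq' Finset.univ i]
  simp

theorem cliffordSign_mul_self (r : Fin m → Prop) [DecidablePred r] (S : Finset (Fin m)) :
    cliffordSign r S * cliffordSign r S = 1 := by
  rw [cliffordSign, ← Finset.prod_mul_distrib]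
  exact Finset.prod_eq_one fun k _ => by split_ifs <;> simp

theorem star_cliffordSign (r : Fin m → Prop) [DecidablePred r] (S : Finset (Fin m)) :
    star (cliffordSign r S) = cliffordSign r S := by
  rw [cliffordSign, star_prod]
  exact Finset.prod_congr rfl fun k _ => by split_ifs <;> simp

/-- The signed permutation matrix adding `i` to a set or removing it. -/
def toggleMatrix (r : Fin m → Prop) [DecidablePred r] (i : Fin m) :
    Matrix (Finset (Fin m)) (Finset (Fin m)) ℂ :=
  Matrix.of fun T S => if T = symmDiff S {i} then cliffordSign r S else 0

theorem toggleMatrix_mul (r r' : Fin m → Prop) [DecidablePred r] [DecidablePred r']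
    (i j : Fin m) (T S : Finset (Fin m)) :
    (toggleMatrix r i * toggleMatrix r' j) T S =
      if T = symmDiff (symmDiff S {j}) {i} then
        cliffordSign r S * cliffordSign r' S * (if r j then -1 else 1) else 0 := by
  rw [Matrix.mul_apply, Finset.sum_eq_single (symmDiff S {j})]
  · simp only [toggleMatrix, Matrix.of_apply, if_true, cliffordSign_symmDiff]
    rw [ite_mul, zero_mul]
    congr 1
    ring
  · intro U _ hU
    simp [toggleMatrix, hU]
  · simp

/-- Toggling `i` is an involution and, as `r i` fails, leaves the sign unchanged. -/
theorem star_toggleMatrix (r : Fin m → Prop) [DecidablePred r] {i : Fin m} (hi : ¬ r i) :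
    star (toggleMatrix r i) = toggleMatrix r i := by
  ext T S
  have h : S = symmDiff T {i} ↔ T = symmDiff S {i} := by
    constructor <;> rintro rfl <;> rw [symmDiff_symmDiff_cancel_right]
  simp only [Matrix.star_apply, toggleMatrix, Matrix.of_apply, h]
  split_ifs with hT
  · rw [star_cliffordSign, hT, cliffordSign_symmDiff, if_neg hi, mul_one]
  · simp

/-- Left multiplication by a generator of the Clifford algebra. -/
def cliffordLeft (i : Fin m) : Matrix (Finset (Fin m)) (Finset (Fin m)) ℂ :=
  toggleMatrix (· < i) i

/-- Right multiplication by a generator of the Clifford algebra. -/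
def cliffordRight (i : Fin m) : Matrix (Finset (Fin m)) (Finset (Fin m)) ℂ :=
  toggleMatrix (i < ·) i

theorem star_cliffordLeft (i : Fin m) : star (cliffordLeft i) = cliffordLeft i :=
  star_toggleMatrix _ (lt_irrefl i)

theorem star_cliffordRight (i : Fin m) : star (cliffordRight i) = cliffordRight i :=
  star_toggleMatrix _ (lt_irrefl i)

/-- For `i ≠ j`, exactly one of the two orders of toggling meets an additional sign. -/
theorem cliffordLeft_anticommute (i j : Fin m) :
    cliffordLeft i * cliffordLeft j + cliffordLeft j * cliffordLeft i =
      if i = j then 2 else 0 := by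
  ext T S
  simp only [Matrix.add_apply, cliffordLeft, toggleMatrix_mul]
  rw [symmDiff_right_comm S {j} {i}]
  rcases lt_trichotomy i j with h | rfl | h
  · simp only [h, h.not_gt, h.ne, if_true, if_false, Matrix.zero_apply]
    split_ifs <;> ring
  · simp only [lt_irrefl, if_true, if_false, cliffordSign_mul_self, symmDiff_symmDiff_cancel_right]
    by_cases hT : T = S
    · simp only [hT, Matrix.ofNat_apply]
      norm_num
    · simp [hT, Matrix.ofNat_apply]
  · simp only [h, h.not_gt, h.ne', if_true, if_false, Matrix.zero_apply]
    split_ifs <;> ring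

theorem cliffordRight_anticommute (i j : Fin m) :
    cliffordRight i * cliffordRight j + cliffordRight j * cliffordRight i =
      if i = j then 2 else 0 := by
  ext T S
  simp only [Matrix.add_apply, cliffordRight, toggleMatrix_mul]
  rw [symmDiff_right_comm S {j} {i}]
  rcases lt_trichotomy i j with h | rfl | h
  · simp only [h, h.not_gt, h.ne, if_true, if_false, Matrix.zero_apply]
    split_ifs <;> ring
  · simp only [lt_irrefl, if_true, if_false, cliffordSign_mul_self, symmDiff_symmDiff_cancel_right]
    by_cases hT : T = S
    · simp only [hT, Matrix.ofNat_apply]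
      norm_num
    · simp [hT, Matrix.ofNat_apply]
  · simp only [h, h.not_gt, h.ne', if_true, if_false, Matrix.zero_apply]
    split_ifs <;> ring

/-- Associativity of the Clifford algebra: both orders of toggling pick up the additional sign
exactly when `j < i`. -/
theorem commute_cliffordLeft_cliffordRight (i j : Fin m) :
    Commute (cliffordLeft i) (cliffordRight j) := by
  ext T S
  simp only [cliffordLeft, cliffordRight, toggleMatrix_mul]
  rw [symmDiff_right_comm S {j} {i}, mul_comm (cliffordSign (· < i) S)]

theorem cliffordLeft_empty (i : Fin m) : cliffordLeft i ∅ ∅ = 0 := by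
  have h : symmDiff (∅ : Finset (Fin m)) {i} = {i} := bot_symmDiff _
  simp [cliffordLeft, toggleMatrix, h, (Finset.singleton_ne_empty i).symm]

theorem cliffordRight_empty (i : Fin m) : cliffordRight i ∅ ∅ = 0 := by
  have h : symmDiff (∅ : Finset (Fin m)) {i} = {i} := bot_symmDiff _
  simp [cliffordRight, toggleMatrix, h, (Finset.singleton_ne_empty i).symm]

theorem cliffordLeft_mul_cliffordRight_empty (i j : Fin m) :
    (cliffordLeft i * cliffordRight j) ∅ ∅ = if i = j then 1 else 0 := by
  have h : (∅ : Finset (Fin m)) = symmDiff (symmDiff ∅ {j}) {i} ↔ i = j := by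
    rw [show symmDiff (∅ : Finset (Fin m)) {j} = {j} from bot_symmDiff _, eq_comm,
      show (∅ : Finset (Fin m)) = ⊥ from rfl, symmDiff_eq_bot, Finset.singleton_inj, eq_comm]
  simp only [cliffordLeft, cliffordRight, toggleMatrix_mul, h]
  by_cases hij : i = j
  · subst hij
    simp [cliffordSign]
  · simp [hij]

end Clifford

section Observables

variable {R : Type*} [Ring R] [Algebra ℂ R] {ι : Type*} [Fintype ι] [DecidableEq ι]

/-- Averaging the double sum with its transpose leaves only anticommutators, and among them only the
diagonal. -/
theorem sum_smul_mul_self {L : ι → R} (hL : ∀ i j, L i * L j + L j * L i = if i = j then 2 else 0)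
    {u : ι → ℝ} (hu : ∑ i, u i ^ 2 = 1) :
    (∑ i, (u i : ℂ) • L i) * (∑ i, (u i : ℂ) • L i) = 1 := by
  have h₁ : (∑ i, (u i : ℂ) • L i) * (∑ i, (u i : ℂ) • L i) =
      ∑ i, ∑ j, ((u i : ℂ) * u j) • (L i * L j) := by
    simp only [Finset.sum_mul_sum, smul_mul_smul_comm]
  have h₂ : ∑ i, ∑ j, ((u i : ℂ) * u j) • (L i * L j) =
      ∑ i, ∑ j, ((u i : ℂ) * u j) • (L j * L i) := by
    rw [Finset.sum_comm]
    simp only [mul_comm]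
  have h₃ : (2 : ℂ) • ((∑ i, (u i : ℂ) • L i) * (∑ i, (u i : ℂ) • L i)) = (2 : ℂ) • 1 := by
    rw [two_smul, h₁]
    nth_rw 2 [h₂]
    simp only [← Finset.sum_add_distrib, ← smul_add, hL, smul_ite, smul_zero, Finset.sum_ite_eq,
      Finset.mem_univ, if_true]
    rw [← Finset.sum_smul]
    have : ∑ i, (u i : ℂ) * u i = 1 := by
      rw [← Complex.ofReal_one, ← hu]
      push_cast
      simp only [sq]
    rw [this, one_smul, two_smul, one_add_one_eq_two]
  exact smul_right_injective R (two_ne_zero (α := ℂ)) h₃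

end Observables

/-- The projective measurement of an observable with values `±1`. -/
theorem isProjectiveMeasurement_of_observable {H : Type*} [NormedAddCommGroup H]
    [InnerProductSpace ℂ H] [CompleteSpace H] {T : H →L[ℂ] H} (hT : star T = T) (hTT : T * T = 1) :
    IsProjectiveMeasurement fun a : ℤˣ => (1 / 2 : ℂ) • (1 + ((a : ℤ) : ℂ) • T) where
  selfAdjoint a := by
    simp [IsSelfAdjoint, hT]
  idem a := by
    rw [smul_mul_smul_comm]
    rcases Int.units_eq_one_or a with rfl | rfl <;> simp [add_mul, mul_add, hTT] <;> module
  orthogonal a a' h := by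
    rw [smul_mul_smul_comm]
    rcases Int.units_eq_one_or a with rfl | rfl <;>
      rcases Int.units_eq_one_or a' with rfl | rfl <;>
      first
        | exact absurd rfl h
        | (simp only [Units.val_one, Units.val_neg, Int.cast_one, Int.cast_neg, one_smul, neg_smul,
            add_mul, mul_add, mul_neg, neg_mul, hTT, one_mul, mul_one]; module)
  sum_eq_one := by
    rw [UnitsInt.univ, Finset.sum_insert (by decide), Finset.sum_singleton]
    simp
    module

/-- Tsirelson's construction: the observables are left multiplication by `u x` and right
multiplication by `v y`, the state is the unit `e_∅` of the Clifford algebra. The single observables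
have mean `0` there, their product has mean `∑ i, u x i * v y i`. -/
theorem ofCorrelation_mem_quantumSet_of_unit {X Y : Type*} {m : ℕ} {u : X → Fin m → ℝ}
    {v : Y → Fin m → ℝ} (hu : ∀ x, ∑ i, u x i ^ 2 = 1) (hv : ∀ y, ∑ i, v y i ^ 2 = 1) :
    ofCorrelation (fun x y => ∑ i, u x i * v y i) ∈ quantumSet X Y ℤˣ ℤˣ := by
  let Φ := Matrix.toEuclideanCLM (n := Finset (Fin m)) (𝕜 := ℂ)
  let S : X → Matrix (Finset (Fin m)) (Finset (Fin m)) ℂ := fun x =>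
    ∑ i, (u x i : ℂ) • cliffordLeft i
  let T : Y → Matrix (Finset (Fin m)) (Finset (Fin m)) ℂ := fun y =>
    ∑ i, (v y i : ℂ) • cliffordRight i
  have hS : ∀ x, star (S x) = S x := fun x => by simp [S, star_cliffordLeft]
  have hT : ∀ y, star (T y) = T y := fun y => by simp [T, star_cliffordRight]
  have hST : ∀ x y, Commute (S x) (T y) := fun x y =>
    Commute.sum_left _ _ _ fun i _ => Commute.sum_right _ _ _ fun j _ =>
      ((commute_cliffordLeft_cliffordRight i j).smul_left _).smul_right _
  have hS0 : ∀ x, S x ∅ ∅ = 0 := fun x => by simp [S, Matrix.sum_apply, cliffordLeft_empty]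
  have hT0 : ∀ y, T y ∅ ∅ = 0 := fun y => by simp [T, Matrix.sum_apply, cliffordRight_empty]
  have hST0 : ∀ x y, (S x * T y) ∅ ∅ = ((∑ i, u x i * v y i : ℝ) : ℂ) := fun x y => by
    simp only [S, T, Finset.sum_mul_sum, smul_mul_smul_comm, Matrix.sum_apply, Matrix.smul_apply,
      cliffordLeft_mul_cliffordRight_empty]
    simp
  have hinner : ∀ N : Matrix (Finset (Fin m)) (Finset (Fin m)) ℂ,
      inner ℂ (EuclideanSpace.single ∅ (1 : ℂ)) (Φ N (EuclideanSpace.single ∅ 1)) = N ∅ ∅ :=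
    fun N => by
      simp [Φ, EuclideanSpace.inner_single_left]
  refine ⟨EuclideanSpace ℂ (Finset (Fin m)), inferInstance, inferInstance, inferInstance,
    EuclideanSpace.single ∅ 1, fun x a => (1 / 2 : ℂ) • (1 + ((a : ℤ) : ℂ) • Φ (S x)),
    fun y b => (1 / 2 : ℂ) • (1 + ((b : ℤ) : ℂ) • Φ (T y)), by simp, fun x => ?_, fun y => ?_,
    fun x y a b => ?_, fun x y a b => ?_⟩
  · refine isProjectiveMeasurement_of_observable (by rw [← map_star, hS]) ?_
    rw [← map_mul, sum_smul_mul_self cliffordLeft_anticommute (hu x), map_one]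
  · refine isProjectiveMeasurement_of_observable (by rw [← map_star, hT]) ?_
    rw [← map_mul, sum_smul_mul_self cliffordRight_anticommute (hv y), map_one]
  · refine Commute.smul_left (Commute.smul_right ?_ _) _
    refine (Commute.one_left _).add_left (((Commute.one_right _).add_right ?_).smul_left _)
    exact ((hST x y).map Φ).smul_right _
  · have e : ((1 / 2 : ℂ) • (1 + ((a : ℤ) : ℂ) • Φ (S x))) *
        ((1 / 2 : ℂ) • (1 + ((b : ℤ) : ℂ) • Φ (T y))) =
        Φ ((1 / 4 : ℂ) • (1 + ((a : ℤ) : ℂ) • S x + ((b : ℤ) : ℂ) • T y +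
          (((a : ℤ) : ℂ) * ((b : ℤ) : ℂ)) • (S x * T y))) := by
      simp only [map_smul, map_add, map_mul, map_one, smul_mul_smul_comm, add_mul, mul_add,
        one_mul, mul_one]
      module
    rw [← mul_apply_eq_comp, e, hinner]
    simp only [Matrix.smul_apply, Matrix.add_apply, hS0, hT0, hST0, ofCorrelation]
    push_cast
    simp
    ring

/-- Inner products of vectors of norm at most `1` are quantum correlations. -/
theorem ofCorrelation_mem_quantumSet {X Y : Type*} [Finite X] [Finite Y] {K : Type*}
    [NormedAddCommGroup K] [InnerProductSpace ℝ K] {u : X → K} {v : Y → K} (hu : ∀ x, ‖u x‖ ≤ 1)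
    (hv : ∀ y, ‖v y‖ ≤ 1) :
    ofCorrelation (fun x y => inner ℝ (u x) (v y)) ∈ quantumSet X Y ℤˣ ℤˣ := by
  let W : Submodule ℝ K := Submodule.span ℝ (Set.range u ∪ Set.range v)
  have : FiniteDimensional ℝ W :=
    FiniteDimensional.span_of_finite ℝ ((Set.finite_range u).union (Set.finite_range v))
  let u' : X → W := fun x => ⟨u x, Submodule.subset_span (Or.inl ⟨x, rfl⟩)⟩
  let v' : Y → W := fun y => ⟨v y, Submodule.subset_span (Or.inr ⟨y, rfl⟩)⟩
  let b := stdOrthonormalBasis ℝ W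
  have hsq : ∀ w : W, ∑ i, inner ℝ (b i) w ^ 2 = ‖w‖ ^ 2 := fun w => by
    rw [← real_inner_self_eq_norm_sq, ← b.sum_inner_mul_inner w w]
    exact Finset.sum_congr rfl fun i _ => by rw [real_inner_comm w (b i), sq]
  -- Two additional coordinates, one for each family, complete the vectors to norm `1`. The other
  -- family vanishes there, so the inner products do not change.
  have h := ofCorrelation_mem_quantumSet_of_unit
    (u := fun x => (Fin.cons (Real.sqrt (1 - ‖u x‖ ^ 2)) (Fin.cons 0 fun i => inner ℝ (b i) (u' x)) :
      Fin (_ + 2) → ℝ))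
    (v := fun y => (Fin.cons 0 (Fin.cons (Real.sqrt (1 - ‖v y‖ ^ 2))
      fun i => inner ℝ (b i) (v' y)) : Fin (_ + 2) → ℝ))
    (fun x => by
      have : ‖u x‖ ^ 2 ≤ 1 := pow_le_one₀ (norm_nonneg _) (hu x)
      simp only [Fin.sum_univ_succ, Fin.cons_zero, Fin.cons_succ, hsq]
      rw [Real.sq_sqrt (by linarith)]
      simp [u'])
    (fun y => by
      have : ‖v y‖ ^ 2 ≤ 1 := pow_le_one₀ (norm_nonneg _) (hv y)
      simp only [Fin.sum_univ_succ, Fin.cons_zero, Fin.cons_succ, hsq]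
      rw [Real.sq_sqrt (by linarith)]
      simp [v'])
  convert h using 2
  funext x y
  simp only [Fin.sum_univ_succ, Fin.cons_zero, Fin.cons_succ, zero_mul, mul_zero, zero_add]
  rw [show inner ℝ (u x) (v y) = inner ℝ (u' x) (v' y) from rfl, ← b.sum_inner_mul_inner]
  exact Finset.sum_congr rfl fun i _ => by rw [real_inner_comm]

/-! ### Correlations produced by quantum protocols. -/

theorem IsProjectiveMeasurement.observable_mem_unitary {H : Type*} [NormedAddCommGroup H]
    [InnerProductSpace ℂ H] [CompleteSpace H] {E : ℤˣ → H →L[ℂ] H}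
    (hE : IsProjectiveMeasurement E) :
    ∑ a : ℤˣ, ((a : ℤ) : ℂ) • E a ∈ unitary (H →L[ℂ] H) := by
  have hs : ∑ a : ℤˣ, ((a : ℤ) : ℂ) • E a = E 1 - E (-1) := by
    rw [UnitsInt.univ, Finset.sum_insert (by decide), Finset.sum_singleton]
    simp [sub_eq_add_neg]
  have h1 : E 1 + E (-1) = 1 := by
    rw [← hE.sum_eq_one, UnitsInt.univ, Finset.sum_insert (by decide), Finset.sum_singleton]
  have hstar : star (E 1 - E (-1)) = E 1 - E (-1) := by
    rw [star_sub, (hE.selfAdjoint _).star_eq, (hE.selfAdjoint _).star_eq]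
  have hsq : (E 1 - E (-1)) * (E 1 - E (-1)) = 1 := by
    rw [sub_mul, mul_sub, mul_sub, hE.idem, hE.idem, hE.orthogonal _ _ (by decide),
      hE.orthogonal _ _ (by decide), ← h1]
    abel
  rw [hs, Unitary.mem_iff, hstar, hsq]
  simp

/-- The `±1` observable is unitary and `star k` is a contraction, so the bound involves the
acceptance amplitude only once. This is what improves `4 ^ q` to `2 ^ q`. -/
theorem norm_conj_observable_le {K : Type*} [NormedAddCommGroup K] [InnerProductSpace ℂ K]
    [CompleteSpace K] {E : ℤˣ → K →L[ℂ] K} (hE : IsProjectiveMeasurement E) {k : K →L[ℂ] K}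
    (hk : ‖k‖ ≤ 1) (v : K) :
    ‖(∑ a : ℤˣ, ((a : ℤ) : ℂ) • (star k * E a * k)) v‖ ≤ ‖k v‖ := by
  have h : ∑ a : ℤˣ, ((a : ℤ) : ℂ) • (star k * E a * k) =
      star k * (∑ a : ℤˣ, ((a : ℤ) : ℂ) • E a) * k := by
    simp only [Finset.mul_sum, Finset.sum_mul, mul_smul_comm, smul_mul_assoc]
  rw [h, mul_assoc, mul_apply_eq_comp, mul_apply_eq_comp]
  refine (ContinuousLinearMap.le_of_opNorm_le _ ((norm_star k).le.trans hk) _).trans ?_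
  rw [one_mul, ContinuousLinearMap.norm_map_of_mem_unitary hE.observable_mem_unitary]

theorem SimulableWithQubits.hasAffineModel_ofCorrelation {X Y : Type*} [Finite X] [Finite Y]
    {C : X → Y → ℝ} {q : ℕ} (h : SimulableWithQubits (ofCorrelation C) q) :
    HasAffineModel (quantumSet X Y ℤˣ ℤˣ) (ofCorrelation C) (2 ^ q) := by
  obtain ⟨K, _, _, _, w, kA, kB, E, F, rA, rB, hw, hkA, hkB, hE, hF, hrA, hrB, hr, hA, hB, hc,
    hpK⟩ := h.exists_postselected
  -- The relevant inner products are real, so `K` may be viewed as a real space.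
  let _ : InnerProductSpace ℝ K := InnerProductSpace.rclikeToReal ℂ K
  have hr0 : 0 < rA * rB := by rw [hr]; positivity
  have hrA : 0 < rA := pos_of_mul_pos_left hr0 hrB
  have hrB : 0 < rB := pos_of_mul_pos_right hr0 hrA.le
  let S : X → K →L[ℂ] K := fun x => ∑ a : ℤˣ, ((a : ℤ) : ℂ) • (star (kA x) * E x a * kA x)
  let T : Y → K →L[ℂ] K := fun y => ∑ b : ℤˣ, ((b : ℤ) : ℂ) • (star (kB y) * F y b * kB y)
  have hS : ∀ x, star (S x) = S x := fun x => by
    simp [S, ((hE x).selfAdjoint _).star_eq, mul_assoc]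
  have hST : ∀ x y, inner ℂ (S x w) (T y w) = (((1 / 4) ^ q * C x y : ℝ) : ℂ) := fun x y => by
    have hS' : ContinuousLinearMap.adjoint (S x) = S x := hS x
    rw [← hS', ContinuousLinearMap.adjoint_inner_left, ← sum_ofCorrelation C x y]
    simp only [S, T, sum_apply, smul_apply, map_sum, map_smul, inner_sum, inner_smul_right, hpK]
    push_cast
    simp only [Finset.mul_sum]
    rw [Finset.sum_comm]
    refine Finset.sum_congr rfl fun a _ => Finset.sum_congr rfl fun b _ => ?_
    ring
  have key : ∀ s : ℝ, |s| ≤ 1 →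
      ofCorrelation (fun x y => s * C x y / 2 ^ q) ∈ quantumSet X Y ℤˣ ℤˣ := fun s hs => by
    have h := ofCorrelation_mem_quantumSet (u := fun x => (s / rA) • S x w)
      (v := fun y => (1 / rB) • T y w)
      (fun x => by
        rw [norm_smul, norm_div, Real.norm_eq_abs, Real.norm_of_nonneg hrA.le, div_mul_eq_mul_div,
          div_le_one hrA]
        exact (mul_le_of_le_one_left (norm_nonneg _) hs).trans
          ((norm_conj_observable_le (hE x) (hkA x) w).trans (hA x)))
      (fun y => by
        rw [norm_smul, norm_div, norm_one, Real.norm_of_nonneg hrB.le, div_mul_eq_mul_div,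
          div_le_one hrB, one_mul]
        exact (norm_conj_observable_le (hF y) (hkB y) w).trans (hB y))
    convert h using 2
    funext x y
    rw [real_inner_smul_left, real_inner_smul_right, real_inner_eq_re_inner ℂ, hST]
    -- Dividing the vectors by `rA` and `rB` uses up one factor `(1 / 2) ^ q` and leaves `C / 2 ^
    -- q`.
    have h4 : (1 / 4 : ℝ) ^ q = rA * rB * (1 / 2) ^ q := by
      rw [hr, ← mul_pow]
      norm_num
    rw [RCLike.re_eq_complex_re, Complex.ofReal_re, h4, one_div_pow]
    field_simp
  refine _root_.hasAffineModel_ofCorrelation (one_le_pow₀ one_le_two) ?_ ?_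
  · simpa using key 1 (by simp)
  · simpa using key (-1) (by simp)

/-! ### Lower bounds on communication -/

/-- A finite infimum in `ℕ∞` comes from a nonempty set and is attained. -/
theorem exists_simulableWithBits_of_le {X Y A B : Type*} {p : Behavior X Y A B} {t : ℕ}
    (h : publicCoinComplexity p ≤ t) : ∃ s ≤ t, SimulableWithBits p s := by
  have hne : {c : ℕ∞ | ∃ s : ℕ, c = s ∧ SimulableWithBits p s}.Nonempty := by
    by_contra hne
    rw [publicCoinComplexity, Set.not_nonempty_iff_eq_empty.1 hne, sInf_empty] at h
    exact absurd h (by simp)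
  obtain ⟨s, hs, hp⟩ := csInf_mem hne
  refine ⟨s, ?_, hp⟩
  rw [publicCoinComplexity, hs] at h
  exact_mod_cast h

theorem exists_simulableWithQubits_of_le {X Y A B : Type*} [Fintype A] [Fintype B]
    {p : Behavior X Y A B} {q : ℕ} (h : entangledComplexity p ≤ q) :
    ∃ s ≤ q, SimulableWithQubits p s := by
  have hne : {c : ℕ∞ | ∃ s : ℕ, c = s ∧ SimulableWithQubits p s}.Nonempty := by
    by_contra hne
    rw [entangledComplexity, Set.not_nonempty_iff_eq_empty.1 hne, sInf_empty] at h
    exact absurd h (by simp)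
  obtain ⟨s, hs, hp⟩ := csInf_mem hne
  refine ⟨s, ?_, hp⟩
  rw [entangledComplexity, hs] at h
  exact_mod_cast h

/-- Without inputs every behavior is the empty function, which equals `0`. This covers the case in
which no default outcomes need exist. -/
theorem hasAffineModel_of_isEmpty {X Y A B : Type*} {S : Set (Behavior X Y A B)}
    (p : Behavior X Y A B) (h : ¬(Nonempty X ∧ Nonempty Y)) : HasAffineModel S p 0 := by
  have : p = 0 := by
    funext x y
    exact absurd ⟨⟨x⟩, ⟨y⟩⟩ h
  rw [this]
  exact .zero

end

theorem mainTheorem1 {X Y A B : Type*} [Finite X] [Finite Y] [Fintype A] [Fintype B]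
    [DecidableEq A] [DecidableEq B]
    (p : Behavior X Y A B) (hp : IsNonSignaling p)
    (C : X → Y → ℝ) (hC : ∀ x y, C x y ∈ Set.Icc (-1 : ℝ) 1) (t q : ℕ) :
    (publicCoinComplexity p ≤ t →
      nuTilde p ≤ (((2 : ℝ) ^ (t + 1) - 1 : ℝ) : EReal)) ∧
    (publicCoinComplexity (ofCorrelation C) ≤ t →
      nuTilde (ofCorrelation C) ≤ (((2 : ℝ) ^ t : ℝ) : EReal)) ∧
    (entangledComplexity p ≤ q →
      gammaTwoTilde p ≤ (((2 : ℝ) ^ (2 * q + 1) - 1 : ℝ) : EReal)) ∧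
    (entangledComplexity (ofCorrelation C) ≤ q →
      gammaTwoTilde (ofCorrelation C) ≤ (((2 : ℝ) ^ q : ℝ) : EReal)) := by
  have hpow : ∀ {m n : ℕ}, m ≤ n → (2 : ℝ) ^ m ≤ 2 ^ n := fun h => pow_le_pow_right₀ one_le_two h
  refine ⟨fun h => ?_, fun h => ?_, fun h => ?_, fun h => ?_⟩
  · obtain ⟨s, hs, hp'⟩ := exists_simulableWithBits_of_le h
    refine HasAffineModel.affineCost_le ?_
    by_cases hne : Nonempty X ∧ Nonempty Y
    · obtain ⟨_, _⟩ := hne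
      exact (hp'.hasAffineModel hp).mono (sub_le_sub_right (hpow (Nat.succ_le_succ hs)) 1)
    · exact (hasAffineModel_of_isEmpty p hne).mono (sub_nonneg.2 (one_le_pow₀ one_le_two))
  · obtain ⟨s, hs, hp'⟩ := exists_simulableWithBits_of_le h
    exact (hp'.hasAffineModel_ofCorrelation.mono (hpow hs)).affineCost_le
  · obtain ⟨s, hs, hp'⟩ := exists_simulableWithQubits_of_le h
    refine HasAffineModel.affineCost_le ?_
    by_cases hne : Nonempty X ∧ Nonempty Y
    · obtain ⟨_, _⟩ := hne
      exact (hp'.hasAffineModel hp).mono (sub_le_sub_right (hpow (by omega)) 1)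
    · exact (hasAffineModel_of_isEmpty p hne).mono (sub_nonneg.2 (one_le_pow₀ one_le_two))
  · obtain ⟨s, hs, hp'⟩ := exists_simulableWithQubits_of_le h
    exact (hp'.hasAffineModel_ofCorrelation.mono (hpow hs)).affineCost_le
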